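/- Let $n\ge 1$. A spacetime $(M,g)$ is a connected, oriented and time-oriented smooth manifold $M$ of dimension $n+1$ (Hausdorff, second countable, without boundary) with a smooth Lorentzian metric $g$ of signature $(-,+,\dots,+)$. Hypersurfaces are smooth, embedded and without boundary; a hypersurface is null if the metric induced on each of its tangent spaces is degenerate. A Killing horizon of a Killing vector field $\xi$ of $(M,g)$ is a non-empty null hypersurface $\mathcal H_\xi$ on which $\xi$ is null, nowhere zero and tangent; it may have several connected components, but then the interior of its closure (the set of points of $\overline{\mathcal H_\xi}$ near which $\overline{\mathcal H_\xi}$ is a hypersurface) is required to be connected. The surface gravity $\kappa_\xi$ of $\xi$ on $\mathcal H_\xi$ is the function defined by $\operatorname{grad}(g(\xi,\xi))=-2\kappa_\xi\,\xi$ on $\mathcal H_\xi$. A null hypersurface $\mathcal H$ is a multiple Killing horizon (MKH) if there are $m\ge 2$ linearly independent Killing vectors $\xi_1,\dots,\xi_m$ with Killing horizons $\mathcal H_{\xi_i}$ such that $\overline{\mathcal H}=\overline{\mathcal H_{\xi_1}}=\dots=\overline{\mathcal H_{\xi_m}}$. For an MKH $\mathcal H$ let $\mathcal A_{\mathcal H}$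 consist of the zero vector field and all Killing vectors $\xi$ that have a Killing horizon $\mathcal H_\xi$ with $\overline{\mathcal H_\xi}=\overline{\mathcal H}$, and let $\mathcal A^{deg}_{\mathcal H}\subseteq\mathcal A_{\mathcal H}$ consist of the zero vector field and those $\xi$ for which in addition $\kappa_\xi=0$ on $\mathcal H_\xi$. The order of $\mathcal H$ is $\dim\mathcal A_{\mathcal H}$ (dimensions are those of linear spans), and $\mathcal H$ is fully degenerate if $\mathcal A_{\mathcal H}=\mathcal A^{deg}_{\mathcal H}$. Then, among all MKHs in $(n+1)$-dimensional spacetimes, the maximum possible dimension of $\mathcal A^{deg}_{\mathcal H}$ is $n$, and the maximum possible order is 1. $n$ for fully degenerate $\mathcal H$, 2. $n+1$ for non-fully degenerate $\mathcal H$. That is, $\dim\mathcal A^{deg}_{\mathcal H}\le n$ for every MKH $\mathcal H$; the order is at most $n$ if $\mathcal H$ is fully degenerate and at most $n+1$ if it is not; and each of these three bounds is attained by some MKH in some $(n+1)$-dimensional spacetime, the one for fully degenerate MKHs under the assumption $n\ge 2$ (for $n=1$ there is no fully degenerate MKH, because the order of an MKH is at least $2$). -/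

import Mathlib

open Set Topology Manifold ContDiff Bundle

universe u

noncomputable section

/-- `M` is orientable: it carries a smooth atlas all of whose transition maps have
positive Jacobian determinant. -/
def IsOrientableManifold (n : ℕ) (M : Type u) [TopologicalSpace M]
    [ChartedSpace (EuclideanSpace ℝ (Fin (n + 1))) M] : Prop :=
  ∃ A ⊆ IsManifold.maximalAtlas (𝓡 (n + 1)) ∞ M,
    (∀ x : M, ∃ e ∈ A, x ∈ e.source) ∧
    ∀ e ∈ A, ∀ e' ∈ A, ∀ x ∈ e.source ∩ e'.source,
      0 < (fderiv ℝ (fun y => e' (e.symm y)) (e x)).det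

/-- A smooth Lorentzian metric of signature `(-,+,…,+)` on an `(n+1)`-dimensional manifold. -/
structure LorentzMetric (n : ℕ) (M : Type u) [TopologicalSpace M]
    [ChartedSpace (EuclideanSpace ℝ (Fin (n + 1))) M] [IsManifold (𝓡 (n + 1)) ∞ M] where
  /-- The bilinear form on each tangent space. -/
  inner (x : M) : TangentSpace (𝓡 (n + 1)) x →L[ℝ] TangentSpace (𝓡 (n + 1)) x →L[ℝ] ℝ
  symm (x : M) (v w : TangentSpace (𝓡 (n + 1)) x) : inner x v w = inner x w v
  exists_orthonormal_basis (x : M) :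
    ∃ b : Module.Basis (Fin (n + 1)) ℝ (TangentSpace (𝓡 (n + 1)) x),
      ∀ i j, inner x (b i) (b j) = if i = j then (if i = 0 then -1 else 1) else 0
  contMDiff : ContMDiff (𝓡 (n + 1))
    ((𝓡 (n + 1)).prod 𝓘(ℝ, EuclideanSpace ℝ (Fin (n + 1)) →L[ℝ]
      EuclideanSpace ℝ (Fin (n + 1)) →L[ℝ] ℝ)) ∞
    (fun x => TotalSpace.mk' (EuclideanSpace ℝ (Fin (n + 1)) →L[ℝ]
      EuclideanSpace ℝ (Fin (n + 1)) →L[ℝ] ℝ)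
      (E := fun x : M => TangentSpace (𝓡 (n + 1)) x →L[ℝ] TangentSpace (𝓡 (n + 1)) x →L[ℝ] ℝ)
      x (inner x))

/-- An `(n+1)`-dimensional spacetime: a connected, orientable and time-orientable smooth manifold
(Hausdorff, second countable, without boundary) with a Lorentzian metric. -/
structure Spacetime (n : ℕ) where
  /-- The set of points. -/
  Pt : Type u
  [topologicalSpace : TopologicalSpace Pt]
  [chartedSpace : ChartedSpace (EuclideanSpace ℝ (Fin (n + 1))) Pt]
  [isManifold : IsManifold (𝓡 (n + 1)) ∞ Pt]
  [t2Space : T2Space Pt]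
  [secondCountable : SecondCountableTopology Pt]
  [connectedSpace : ConnectedSpace Pt]
  /-- The metric. -/
  metric : LorentzMetric n Pt
  orientable : IsOrientableManifold n Pt
  timeOrientable : ∃ T : Cₛ^∞⟮𝓡 (n + 1); EuclideanSpace ℝ (Fin (n + 1)),
      (TangentSpace (𝓡 (n + 1)) : Pt → Type)⟯, ∀ x, metric.inner x (T x) (T x) < 0

namespace Spacetime

attribute [instance] Spacetime.topologicalSpace Spacetime.chartedSpace Spacetime.isManifold
  Spacetime.t2Space Spacetime.secondCountable Spacetime.connectedSpace

variable {n : ℕ} (S : Spacetime.{u} n)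

/-- The tangent space at a point. -/
abbrev Tangent (x : S.Pt) : Type := TangentSpace (𝓡 (n + 1)) x

/-- The real vector space of smooth vector fields. -/
abbrev SmoothVectorField : Type u :=
  Cₛ^∞⟮𝓡 (n + 1); EuclideanSpace ℝ (Fin (n + 1)), (TangentSpace (𝓡 (n + 1)) : S.Pt → Type)⟯

/-- The metric at a point. -/
abbrev g (x : S.Pt) (v w : S.Tangent x) : ℝ := S.metric.inner x v w

/-- The derivative `df_x(v)` of a real function. -/
def dirDeriv (f : S.Pt → ℝ) (x : S.Pt) (v : S.Tangent x) : ℝ :=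
  mfderiv (𝓡 (n + 1)) 𝓘(ℝ, ℝ) f x v

/-- `ξ` is a Killing vector field: `(L_ξ g)(Y, Z) = ξ(g(Y, Z)) - g([ξ, Y], Z) - g(Y, [ξ, Z])`
vanishes for all (locally defined) smooth vector fields `Y`, `Z`. -/
def IsKilling (ξ : S.SmoothVectorField) : Prop :=
  ∀ (x : S.Pt) (Y Z : (y : S.Pt) → TangentSpace (𝓡 (n + 1)) y),
    ContMDiffAt (𝓡 (n + 1)) (𝓡 (n + 1)).tangent ∞
      (fun y => (⟨y, Y y⟩ : TangentBundle (𝓡 (n + 1)) S.Pt)) x →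
    ContMDiffAt (𝓡 (n + 1)) (𝓡 (n + 1)).tangent ∞
      (fun y => (⟨y, Z y⟩ : TangentBundle (𝓡 (n + 1)) S.Pt)) x →
    S.dirDeriv (fun y => S.g y (Y y) (Z y)) x (ξ x) =
      S.g x (VectorField.mlieBracket (𝓡 (n + 1)) (fun y => ξ y) Y x) (Z x) +
      S.g x (Y x) (VectorField.mlieBracket (𝓡 (n + 1)) (fun y => ξ y) Z x)

/-- `f` is a local defining function of the set `H` on the open neighbourhood `U` of `p`: it is
smooth with nowhere vanishing differential on `U`, and `H ∩ U` is its zero set in `U`. -/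
structure IsDefiningFunction (H : Set S.Pt) (p : S.Pt) (U : Set S.Pt) (f : S.Pt → ℝ) : Prop where
  isOpen : IsOpen U
  mem : p ∈ U
  contMDiffOn : ContMDiffOn (𝓡 (n + 1)) 𝓘(ℝ, ℝ) ∞ f U
  deriv_ne_zero : ∀ q ∈ U, ∃ v : S.Tangent q, S.dirDeriv f q v ≠ 0
  inter_eq : H ∩ U = {q ∈ U | f q = 0}

/-- `H` is a smooth embedded hypersurface (without boundary, possibly disconnected). -/
def IsHypersurface (H : Set S.Pt) : Prop :=
  ∀ p ∈ H, ∃ U f, S.IsDefiningFunction H p U f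

/-- The vector `v` at the point `p` of the hypersurface `H` is tangent to `H`. -/
def IsTangentTo (H : Set S.Pt) (p : S.Pt) (v : S.Tangent p) : Prop :=
  ∀ U f, S.IsDefiningFunction H p U f → S.dirDeriv f p v = 0

/-- `H` is a null hypersurface: the metric induced on each of its tangent spaces is degenerate. -/
def IsNullHypersurface (H : Set S.Pt) : Prop :=
  S.IsHypersurface H ∧
    ∀ p ∈ H, ∃ k : S.Tangent p, k ≠ 0 ∧ S.IsTangentTo H p k ∧
      ∀ v : S.Tangent p, S.IsTangentTo H p v → S.g p k v = 0

/-- The interior of `C` as a hypersurface: the set of the points of `C` near which `C` is a smooth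
embedded hypersurface without boundary. -/
def hypersurfaceInterior (C : Set S.Pt) : Set S.Pt :=
  {p ∈ C | ∃ U f, S.IsDefiningFunction C p U f}

/-- `K` is a Killing horizon of the Killing vector `ξ`. It is non-empty, and it is connected or the
interior of its closure is a smooth connected hypersurface (in Mathlib, `IsConnected` includes
non-emptiness). -/
structure IsKillingHorizon (ξ : S.SmoothVectorField) (K : Set S.Pt) : Prop where
  isKilling : S.IsKilling ξ
  isNullHypersurface : S.IsNullHypersurface K
  null : ∀ p ∈ K, S.g p (ξ p) (ξ p) = 0
  ne_zero : ∀ p ∈ K, ξ p ≠ 0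
  tangent : ∀ p ∈ K, S.IsTangentTo K p (ξ p)
  connected : IsConnected K ∨ IsConnected (S.hypersurfaceInterior (closure K))

/-- `κ` is the surface gravity of `ξ` on its Killing horizon `K`: `grad (g(ξ, ξ)) = -2 κ ξ`
on `K`. -/
def IsSurfaceGravity (ξ : S.SmoothVectorField) (K : Set S.Pt) (κ : S.Pt → ℝ) : Prop :=
  ∀ p ∈ K, ∀ v : S.Tangent p,
    S.dirDeriv (fun q => S.g q (ξ q) (ξ q)) p v = -2 * κ p * S.g p (ξ p) v

/-- `H` is a multiple Killing horizon. -/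
def IsMultipleKillingHorizon (H : Set S.Pt) : Prop :=
  S.IsNullHypersurface H ∧
    ∃ m : ℕ, 2 ≤ m ∧ ∃ ξ : Fin m → S.SmoothVectorField, LinearIndependent ℝ ξ ∧
      ∃ K : Fin m → Set S.Pt, ∀ i, S.IsKillingHorizon (ξ i) (K i) ∧ closure (K i) = closure H

/-- The elements of `A_H`: the zero field, and the Killing vectors that have a Killing horizon with
the same closure as `H`. -/
def horizonKillingSet (H : Set S.Pt) : Set S.SmoothVectorField :=
  {ξ | ξ = 0 ∨ ∃ K, S.IsKillingHorizon ξ K ∧ closure K = closure H}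

/-- The elements of `A_H^deg`: the elements of `A_H` with vanishing surface gravity (by convention
the zero field is one). -/
def degenerateKillingSet (H : Set S.Pt) : Set S.SmoothVectorField :=
  {ξ | ξ = 0 ∨ ∃ K, S.IsKillingHorizon ξ K ∧ closure K = closure H ∧ S.IsSurfaceGravity ξ K 0}

/-- The order of `H`, that is, the dimension of `A_H` (of its linear span, so that the definition
does not presuppose that `A_H` is a linear subspace). -/
def order (H : Set S.Pt) : Cardinal.{u} :=
  Module.rank ℝ (Submodule.span ℝ (S.horizonKillingSet H))

/-- The dimension of `A_H^deg` (of its linear span). -/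
def degenerateDim (H : Set S.Pt) : Cardinal.{u} :=
  Module.rank ℝ (Submodule.span ℝ (S.degenerateKillingSet H))

/-- `H` is fully degenerate: `A_H = A_H^deg`. -/
def IsFullyDegenerate (H : Set S.Pt) : Prop :=
  S.horizonKillingSet H = S.degenerateKillingSet H

end Spacetime

end

/-! Upper bounds. A hypersurface is relatively open in its closure, so finitely many horizons with
the same closure coincide near a common point. There each field is null and tangent, and the null
direction of a null hypersurface is unique, so the fields are pointwise proportional to one of them,
with value k at the point. Subtracting multiples of that field from the others gives Killing fields
vanishing at the point. Their derivatives Z are antisymmetric for the metric (Killing equation),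
send tangent vectors of the horizon into the line of k (proportionality along the horizon), and are
linearly independent, since a Killing field is determined by its value and derivative at one point
(`IsKilling.eq_zero`). For l with g(k, l) ≠ 0, such a Z is determined by Z l, and Z l lies in the
complement of l, which omits k. So k and the vectors Z l are independent in dimension n + 1. If all
surface gravities vanish, k and the vectors Z l also lie in the complement of k, which omits l, and
one more dimension is lost. This is `card_add_one_le_finrank_of_antisymm`, applied in
`card_le_of_isKillingHorizon`.

Sharpness. The metric 2 du dv + a|x|² du² + |dx|² has the null hyperplane u = 0. The fields ∂_v and
q(u) x_i ∂_v - p(u) ∂_i, with p' = q and q' = a p, are Killing and restrict there to 1 and x_i times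
∂_v, with zero surface gravity. For a = 0 (Minkowski space) the boost v ∂_v - u ∂_u is one more
field, with nonzero surface gravity, so two of the bounds are attained at once.

For a = 1 every Killing field X with this horizon is degenerate (`KillingEqAt.horizonRate_eq_zero`).
Its surface gravity is governed by the rate α = ∂_u X^u on u = 0. Conservation of g(γ', X) along two
families of null geodesics, x growing or decaying exponentially in u, expresses the radial part of X
through data on u = 0. That radial part is homogeneous of degree one in the transverse variables,
which forces a scaling law for α whose only continuous solution is zero. -/

set_option maxSynthPendingDepth 3

noncomputable section

/-! ### Killing fields in a normed space: first order data determine the field -/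

section Analysis

variable {E F : Type*} [NormedAddCommGroup E] [NormedSpace ℝ E] [NormedAddCommGroup F]
  [NormedSpace ℝ F]

/-- The derivative of a function vanishing on a regular level set vanishes on the tangent space
of the level set. -/
theorem fderiv_eq_zero_of_eventually_zero_on_level [CompleteSpace E] {F φ : E → ℝ} {z : E}
    (hF : ContDiffAt ℝ 1 F z) (hφ : ContDiffAt ℝ 1 φ z) (hFz : F z = 0)
    (hdF : fderiv ℝ F z ≠ 0) (h : ∀ᶠ y in 𝓝 z, F y = 0 → φ y = 0) {v : E}
    (hv : fderiv ℝ F z v = 0) : fderiv ℝ φ z v = 0 := by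
  have hφz : φ z = 0 := h.self_of_nhds hFz
  -- φ is constant on the level set near z, so z is a constrained extremum and Lagrange multipliers
  -- relate the two differentials.
  have hext : IsLocalExtrOn φ {x | F x = F z} z := by
    left
    have : ∀ᶠ y in 𝓝[{x | F x = F z}] z, φ z ≤ φ y := by
      filter_upwards [nhdsWithin_le_nhds h, self_mem_nhdsWithin] with y hy hy'
      rw [hφz, hy (by simpa [hFz] using hy')]
    exact this
  obtain ⟨a, b, hab, hlin⟩ := hext.exists_multipliers_of_hasStrictFDerivAt_1d
    (hF.hasStrictFDerivAt one_ne_zero) (hφ.hasStrictFDerivAt one_ne_zero)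
  have hb : b ≠ 0 := by
    rintro rfl
    have ha : a ≠ 0 := by simpa using hab
    simp only [zero_smul, add_zero] at hlin
    exact hdF ((smul_eq_zero.1 hlin).resolve_left ha)
  have := congrArg (fun L => L v) hlin
  simp only [add_apply, smul_apply, hv, smul_eq_mul, mul_zero, zero_add, zero_apply] at this
  exact (mul_eq_zero.1 this).resolve_left hb

/-- The Killing equation of the vector field `X` for the metric `G` at the point `z`. -/
def KillingEqAt (G : E → E →L[ℝ] E →L[ℝ] F) (X : E → E) (z : E) : Prop :=
  ∀ v w, fderiv ℝ G z (X z) v w + G z (fderiv ℝ X z v) w + G z v (fderiv ℝ X z w) = 0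

set_option maxHeartbeats 1000000 in
/-- The derivative of the Killing equation in the direction `y`. -/
theorem KillingEqAt.fderiv_eq {G : E → E →L[ℝ] E →L[ℝ] F} {X : E → E} {z : E}
    (hG : ContDiffAt ℝ 2 G z) (hX : ContDiffAt ℝ 2 X z) (h : ∀ᶠ y in 𝓝 z, KillingEqAt G X y)
    (y v w : E) :
    fderiv ℝ (fderiv ℝ G) z y (X z) v w + fderiv ℝ G z (fderiv ℝ X z y) v w
      + (fderiv ℝ G z y (fderiv ℝ X z v) w + G z (fderiv ℝ (fderiv ℝ X) z y v) w)
      + (fderiv ℝ G z y v (fderiv ℝ X z w) + G z v (fderiv ℝ (fderiv ℝ X) z y w)) = 0 := by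
  have hG1 : HasFDerivAt G (fderiv ℝ G z) z := (hG.differentiableAt (by simp)).hasFDerivAt
  have hX1 : HasFDerivAt X (fderiv ℝ X z) z := (hX.differentiableAt (by simp)).hasFDerivAt
  have hG2 : HasFDerivAt (fderiv ℝ G) (fderiv ℝ (fderiv ℝ G) z) z :=
    ((hG.fderiv_right (m := 1) (by norm_num)).differentiableAt (by simp)).hasFDerivAt
  have hX2 : HasFDerivAt (fderiv ℝ X) (fderiv ℝ (fderiv ℝ X) z) z :=
    ((hX.fderiv_right (m := 1) (by norm_num)).differentiableAt (by simp)).hasFDerivAt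
  have c (u : E) : HasFDerivAt (fun _ : E => u) (0 : E →L[ℝ] E) z := hasFDerivAt_const u z
  have h1 := ((hG2.clm_apply hX1).clm_apply (c v)).clm_apply (c w)
  have h2 := (hG1.clm_apply (hX2.clm_apply (c v))).clm_apply (c w)
  have h3 := (hG1.clm_apply (c v)).clm_apply (hX2.clm_apply (c w))
  have h4 := (h1.add h2).add h3
  have h5 := h4.congr_of_eventuallyEq (f₁ := fun _ => (0 : F)) (by
    filter_upwards [h] with y hy
    simpa using (hy v w).symm)
  have h6 := congrArg (fun L => L y) (h5.unique (hasFDerivAt_const (0 : F) z))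
  simpa [add_comm, add_left_comm, add_assoc] using h6

/-- The second derivatives of a Killing field are bounded by the field and its first
derivatives. -/
theorem KillingEqAt.norm_fderiv_fderiv_le {G : E → E →L[ℝ] E →L[ℝ] F} {X : E → E} {z : E}
    {c C : ℝ} (hc : 0 ≤ c) (hC : 0 ≤ C)
    (hG : ContDiffAt ℝ 2 G z) (hX : ContDiffAt ℝ 2 X z) (h : ∀ᶠ y in 𝓝 z, KillingEqAt G X y)
    (hsymm : ∀ v w, G z v w = G z w v)
    (hinv : ∀ v, ‖v‖ ≤ c * ‖G z v‖) (hG1 : ‖fderiv ℝ G z‖ ≤ C)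
    (hG2 : ‖fderiv ℝ (fderiv ℝ G) z‖ ≤ C) :
    ‖fderiv ℝ (fderiv ℝ X) z‖ ≤ 6 * c * C * max ‖X z‖ ‖fderiv ℝ X z‖ := by
  set N := max ‖X z‖ ‖fderiv ℝ X z‖ with hN
  have hN0 : 0 ≤ N := le_max_of_le_left (norm_nonneg _)
  have hsym : ∀ y v, fderiv ℝ (fderiv ℝ X) z y v = fderiv ℝ (fderiv ℝ X) z v y :=
    fun y v => (hX.isSymmSndFDerivAt (by simp)) y v
  -- In the differentiated Killing equation the four terms without second derivatives of X are each
  -- bounded by C N.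
  have bound : ∀ y v w, ‖G z (fderiv ℝ (fderiv ℝ X) z y v) w + G z (fderiv ℝ (fderiv ℝ X) z y w) v‖
      ≤ 4 * C * N * (‖y‖ * ‖v‖ * ‖w‖) := by
    intro y v w
    have e := KillingEqAt.fderiv_eq hG hX h y v w
    rw [hsymm v] at e
    have tri (A : E →L[ℝ] E →L[ℝ] E →L[ℝ] F) (hA : ‖A‖ ≤ C) (a b d : E) :
        ‖A a b d‖ ≤ C * ‖a‖ * ‖b‖ * ‖d‖ := by
      refine ((A a b).le_opNorm d).trans ?_
      gcongr
      refine ((A a).le_opNorm b).trans ?_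
      gcongr
      exact (A.le_opNorm a).trans (by gcongr)
    have dX (a : E) : ‖fderiv ℝ X z a‖ ≤ N * ‖a‖ :=
      ((fderiv ℝ X z).le_opNorm a).trans (by gcongr; exact le_max_right _ _)
    have t1 : ‖fderiv ℝ (fderiv ℝ G) z y (X z) v w‖ ≤ C * N * (‖y‖ * ‖v‖ * ‖w‖) := by
      have hA : ‖fderiv ℝ (fderiv ℝ G) z y‖ ≤ C * ‖y‖ :=
        ((fderiv ℝ (fderiv ℝ G) z).le_opNorm y).trans (by gcongr)
      refine ((fderiv ℝ (fderiv ℝ G) z y (X z) v).le_opNorm w).trans ?_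
      refine (mul_le_mul_of_nonneg_right
        ((fderiv ℝ (fderiv ℝ G) z y (X z)).le_opNorm v) (norm_nonneg _)).trans ?_
      have : ‖fderiv ℝ (fderiv ℝ G) z y (X z)‖ ≤ C * ‖y‖ * N :=
        ((fderiv ℝ (fderiv ℝ G) z y).le_opNorm _).trans (by gcongr; exact le_max_left _ _)
      calc _ ≤ C * ‖y‖ * N * ‖v‖ * ‖w‖ := by gcongr
        _ = _ := by ring
    have t2 : ‖fderiv ℝ G z (fderiv ℝ X z y) v w‖ ≤ C * N * (‖y‖ * ‖v‖ * ‖w‖) :=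
      (tri _ hG1 _ _ _).trans (by
        calc _ ≤ C * (N * ‖y‖) * ‖v‖ * ‖w‖ := by gcongr; exact dX y
          _ = _ := by ring)
    have t3 : ‖fderiv ℝ G z y (fderiv ℝ X z v) w‖ ≤ C * N * (‖y‖ * ‖v‖ * ‖w‖) :=
      (tri _ hG1 _ _ _).trans (by
        calc _ ≤ C * ‖y‖ * (N * ‖v‖) * ‖w‖ := by gcongr; exact dX v
          _ = _ := by ring)
    have t4 : ‖fderiv ℝ G z y v (fderiv ℝ X z w)‖ ≤ C * N * (‖y‖ * ‖v‖ * ‖w‖) :=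
      (tri _ hG1 _ _ _).trans (by
        calc _ ≤ C * ‖y‖ * ‖v‖ * (N * ‖w‖) := by gcongr; exact dX w
          _ = _ := by ring)
    have e' : G z (fderiv ℝ (fderiv ℝ X) z y v) w + G z (fderiv ℝ (fderiv ℝ X) z y w) v
        = -(fderiv ℝ (fderiv ℝ G) z y (X z) v w + fderiv ℝ G z (fderiv ℝ X z y) v w
          + fderiv ℝ G z y (fderiv ℝ X z v) w + fderiv ℝ G z y v (fderiv ℝ X z w)) := by
      rw [eq_neg_iff_add_eq_zero, ← e]
      abel
    rw [e', norm_neg]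
    refine norm_add₄_le.trans ?_
    linarith
  refine ContinuousLinearMap.opNorm_le_bound _ (by positivity) fun y => ?_
  refine ContinuousLinearMap.opNorm_le_bound _ (by positivity) fun v => ?_
  refine (hinv _).trans ?_
  have : ‖G z (fderiv ℝ (fderiv ℝ X) z y v)‖ ≤ 6 * C * N * ‖y‖ * ‖v‖ := by
    refine ContinuousLinearMap.opNorm_le_bound _ (by positivity) fun w => ?_
    have b1 := bound y v w
    have b2 := bound v y w
    have b3 := bound w y v
    rw [hsym v y] at b2
    rw [hsym w y, hsym w v] at b3
    set S := fun a b d => G z (fderiv ℝ (fderiv ℝ X) z a b) d with hS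
    -- The permutation trick of the Christoffel formula: S is symmetric in its first two slots and
    -- antisymmetric in the last two up to `bound`. Three bounds of size 4, halved, give the
    -- constant 6.
    have e : (2 : ℝ) • S y v w = (S y v w + S y w v) + (S y v w + S v w y) - (S y w v + S v w y) := by
      rw [two_smul]
      abel
    have h2 : 2 * ‖S y v w‖ ≤ 3 * (4 * C * N * (‖y‖ * ‖v‖ * ‖w‖)) := by
      calc 2 * ‖S y v w‖ = ‖(2 : ℝ) • S y v w‖ := by rw [norm_smul]; norm_num
        _ ≤ _ := by
          rw [e]
          refine (norm_sub_le _ _).trans ((add_le_add_left (norm_add_le _ _) _).trans ?_)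
          linarith
    linarith
  calc _ ≤ c * (6 * C * N * ‖y‖ * ‖v‖) := by gcongr
    _ = _ := by ring

/-- A Killing field vanishing to first order at a point of a convex set with bounded geometry
vanishes on it. -/
theorem KillingEqAt.eqOn_zero_of_convex {G : E → E →L[ℝ] E →L[ℝ] F} {X : E → E} {O B : Set E}
    {c C : ℝ} (hc : 0 ≤ c) (hC : 0 ≤ C) (hO : IsOpen O) (hBO : B ⊆ O) (hB : Convex ℝ B)
    (hG : ContDiffOn ℝ 2 G O) (hX : ContDiffOn ℝ 2 X O) (h : ∀ z ∈ O, KillingEqAt G X z)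
    (hsymm : ∀ z ∈ B, ∀ v w, G z v w = G z w v)
    (hinv : ∀ z ∈ B, ∀ v, ‖v‖ ≤ c * ‖G z v‖) (hG1 : ∀ z ∈ B, ‖fderiv ℝ G z‖ ≤ C)
    (hG2 : ∀ z ∈ B, ‖fderiv ℝ (fderiv ℝ G) z‖ ≤ C) {y : E} (hy : y ∈ B)
    (hXy : X y = 0) (hdXy : fderiv ℝ X y = 0) : ∀ z ∈ B, X z = 0 := by
  intro z hz
  let γ : ℝ → E := fun t => y + t • (z - y)
  have hγ : ∀ t ∈ Icc (0 : ℝ) 1, γ t ∈ B := fun t ht =>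
    hB.add_smul_sub_mem hy hz ht
  have hγd (t : ℝ) : HasDerivAt γ (z - y) t := by
    simpa [γ] using ((hasDerivAt_id t).smul_const (z - y)).const_add y
  have atX {t : ℝ} (ht : t ∈ Icc (0 : ℝ) 1) : ContDiffAt ℝ 2 X (γ t) :=
    hX.contDiffAt (hO.mem_nhds (hBO (hγ t ht)))
  have atG {t : ℝ} (ht : t ∈ Icc (0 : ℝ) 1) : ContDiffAt ℝ 2 G (γ t) :=
    hG.contDiffAt (hO.mem_nhds (hBO (hγ t ht)))
  let Φ : ℝ → E × (E →L[ℝ] E) := fun t => (X (γ t), fderiv ℝ X (γ t))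
  let Φ' : ℝ → E × (E →L[ℝ] E) := fun t =>
    (fderiv ℝ X (γ t) (z - y), fderiv ℝ (fderiv ℝ X) (γ t) (z - y))
  have hΦ : ∀ t ∈ Icc (0 : ℝ) 1, HasDerivAt Φ (Φ' t) t := by
    intro t ht
    have h1 : HasFDerivAt X (fderiv ℝ X (γ t)) (γ t) :=
      ((atX ht).differentiableAt (by simp)).hasFDerivAt
    have h2 : HasFDerivAt (fderiv ℝ X) (fderiv ℝ (fderiv ℝ X) (γ t)) (γ t) :=
      (((atX ht).fderiv_right (m := 1) (by norm_num)).differentiableAt (by simp)).hasFDerivAt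
    exact (h1.comp_hasDerivAt t (hγd t)).prodMk (h2.comp_hasDerivAt t (hγd t))
  -- Grönwall along the segment: the pair of X and its derivative starts at zero and satisfies a
  -- linear differential inequality.
  have key := eq_zero_of_abs_deriv_le_mul_abs_self_of_eq_zero_right (f := Φ) (f' := Φ')
    (K := max 1 (6 * c * C) * ‖z - y‖) (a := 0) (b := 1)
    (fun t ht => (hΦ t ht).continuousAt.continuousWithinAt)
    (fun t ht => (hΦ t ⟨ht.1, ht.2.le⟩).hasDerivWithinAt)
    (by simp [Φ, γ, hXy, hdXy])
    (fun t ht => by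
      have ht' : t ∈ Icc (0 : ℝ) 1 := ⟨ht.1, ht.2.le⟩
      have hb := KillingEqAt.norm_fderiv_fderiv_le hc hC (atG ht') (atX ht')
        (by filter_upwards [hO.mem_nhds (hBO (hγ t ht'))] with w hw using h w hw)
        (hsymm _ (hγ t ht')) (hinv _ (hγ t ht')) (hG1 _ (hγ t ht')) (hG2 _ (hγ t ht'))
      have hΦn : ‖Φ t‖ = max ‖X (γ t)‖ ‖fderiv ℝ X (γ t)‖ := rfl
      rw [← hΦn] at hb
      refine max_le ?_ ?_
      · refine ((fderiv ℝ X (γ t)).le_opNorm _).trans ?_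
        have : ‖fderiv ℝ X (γ t)‖ ≤ max 1 (6 * c * C) * ‖Φ t‖ := by
          calc _ ≤ 1 * ‖Φ t‖ := by rw [one_mul, hΦn]; exact le_max_right _ _
            _ ≤ _ := by gcongr; exact le_max_left _ _
        calc _ ≤ max 1 (6 * c * C) * ‖Φ t‖ * ‖z - y‖ := by gcongr
          _ = _ := by ring
      · refine ((fderiv ℝ (fderiv ℝ X) (γ t)).le_opNorm _).trans ?_
        have : ‖fderiv ℝ (fderiv ℝ X) (γ t)‖ ≤ max 1 (6 * c * C) * ‖Φ t‖ :=
          hb.trans (by gcongr; exact le_max_right _ _)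
        calc _ ≤ max 1 (6 * c * C) * ‖Φ t‖ * ‖z - y‖ := by gcongr
          _ = _ := by ring)
  have h1 := key 1 ⟨zero_le_one, le_rfl⟩
  have h2 : X (γ 1) = 0 := congrArg Prod.fst h1
  simpa [γ] using h2

omit [NormedSpace ℝ E] in
theorem ContinuousAt.eventually_norm_lt_add_one {W : Type*} [NormedAddCommGroup W] {f : E → W}
    {z : E} (hf : ContinuousAt f z) : ∀ᶠ y in 𝓝 z, ‖f y‖ < ‖f z‖ + 1 :=
  hf.norm.eventually_lt continuousAt_const (by simp)

/-- Every point has a ball in which Killing fields are determined by their first order data at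
any point. -/
theorem KillingEqAt.exists_ball_eq_zero [FiniteDimensional ℝ E] {G : E → E →L[ℝ] E →L[ℝ] F}
    {O : Set E} (hO : IsOpen O) (hG : ContDiffOn ℝ 3 G O)
    (hsymm : ∀ z ∈ O, ∀ v w, G z v w = G z w v) {z₀ : E} (hz₀ : z₀ ∈ O)
    (hnd : ∀ v, (∀ w, G z₀ v w = 0) → v = 0) :
    ∃ r > 0, Metric.ball z₀ r ⊆ O ∧ ∀ X : E → E, ContDiffOn ℝ 2 X O →
      (∀ z ∈ O, KillingEqAt G X z) → ∀ y ∈ Metric.ball z₀ r, X y = 0 → fderiv ℝ X y = 0 →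
        ∀ z ∈ Metric.ball z₀ r, X z = 0 := by
  have hGat : ContDiffAt ℝ 3 G z₀ := hG.contDiffAt (hO.mem_nhds hz₀)
  have hG1 : ContDiffAt ℝ 2 (fderiv ℝ G) z₀ := hGat.fderiv_right (by norm_num)
  have hG2 : ContDiffAt ℝ 1 (fderiv ℝ (fderiv ℝ G)) z₀ := hG1.fderiv_right (by norm_num)
  obtain ⟨K, hK0, hK⟩ := (G z₀).toLinearMap.exists_antilipschitzWith (by
    rw [LinearMap.ker_eq_bot']
    intro v hv
    refine hnd v fun w => ?_
    have : G z₀ v = 0 := hv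
    simp [this])
  have hK0' : (0 : ℝ) < K := by exact_mod_cast hK0
  have hK' : ∀ v, ‖v‖ ≤ K * ‖G z₀ v‖ := fun v => by
    simpa using hK.le_mul_dist v 0
  -- G z₀ is bounded below by 1/K; a perturbation of less than half of that leaves the lower bound
  -- 1/(2K), hence the constant 2 * K.
  have e1 : ∀ᶠ z in 𝓝 z₀, ‖G z - G z₀‖ < (2 * (K : ℝ))⁻¹ := by
    have := hGat.continuousAt.sub (continuousAt_const (y := G z₀))
    have h2 := this.norm
    refine h2.eventually_lt continuousAt_const ?_
    have : (0 : ℝ) < (2 * (K : ℝ))⁻¹ := by positivity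
    simpa using this
  have e2 : ∀ᶠ z in 𝓝 z₀, ‖fderiv ℝ G z‖ < ‖fderiv ℝ G z₀‖ + 1 :=
    ContinuousAt.eventually_norm_lt_add_one (f := fderiv ℝ G) hG1.continuousAt
  have e3 : ∀ᶠ z in 𝓝 z₀,
      ‖fderiv ℝ (fderiv ℝ G) z‖ < ‖fderiv ℝ (fderiv ℝ G) z₀‖ + 1 :=
    ContinuousAt.eventually_norm_lt_add_one (f := fderiv ℝ (fderiv ℝ G)) hG2.continuousAt
  obtain ⟨r, hr, hball⟩ := Metric.eventually_nhds_iff_ball.1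
    (e1.and (e2.and (e3.and (hO.mem_nhds hz₀))))
  refine ⟨r, hr, fun z hz => (hball z hz).2.2.2, ?_⟩
  intro X hX hK2 y hy hXy hdXy
  refine KillingEqAt.eqOn_zero_of_convex (c := 2 * K)
    (C := max (‖fderiv ℝ G z₀‖ + 1) (‖fderiv ℝ (fderiv ℝ G) z₀‖ + 1)) (by positivity)
    (le_max_of_le_left (by positivity)) hO (fun z hz => (hball z hz).2.2.2)
    (convex_ball _ _) (hG.of_le (by norm_num)) hX hK2
    (fun z hz => hsymm z (hball z hz).2.2.2) ?_
    (fun z hz => (hball z hz).2.1.le.trans (le_max_left _ _))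
    (fun z hz => (hball z hz).2.2.1.le.trans (le_max_right _ _)) hy hXy hdXy
  intro z hz v
  have h1 := hK' v
  have h2 : ‖G z₀ v‖ ≤ ‖G z v‖ + (2 * (K : ℝ))⁻¹ * ‖v‖ := by
    have : G z₀ v = G z v - (G z - G z₀) v := by simp
    rw [this]
    refine (norm_sub_le _ _).trans ?_
    gcongr
    exact ((G z - G z₀).le_opNorm v).trans (by gcongr; exact (hball z hz).1.le)
  have h3 : (K : ℝ) * ((2 * (K : ℝ))⁻¹ * ‖v‖) = ‖v‖ / 2 := by field_simp
  have h4 : ‖v‖ ≤ K * ‖G z v‖ + ‖v‖ / 2 := by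
    rw [← h3, ← mul_add]
    exact h1.trans (by gcongr)
  linarith

end Analysis

/-! ### Lorentzian linear algebra and the dimension count -/

section LinearAlgebra

variable {V : Type*} [AddCommGroup V] [Module ℝ V] [TopologicalSpace V]

/-- A Lorentzian scalar product in the coordinates of an orthonormal basis. -/
theorem lorentz_apply_eq_sum {n : ℕ} {B : V →L[ℝ] V →L[ℝ] ℝ}
    {b : Module.Basis (Fin (n + 1)) ℝ V}
    (hb : ∀ i j, B (b i) (b j) = if i = j then (if i = 0 then -1 else 1) else 0) (u v : V) :
    B u v = -(b.repr u 0 * b.repr v 0) + ∑ i : Fin n, b.repr u i.succ * b.repr v i.succ := by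
  conv_lhs => rw [← b.sum_repr u, ← b.sum_repr v]
  simp only [map_sum, map_smul, sum_apply, smul_apply, smul_eq_mul, hb]
  simp [Fin.sum_univ_succ, mul_comm]

/-- Orthogonal null vectors are proportional. -/
theorem exists_eq_smul_of_null_of_orthogonal {n : ℕ} {B : V →L[ℝ] V →L[ℝ] ℝ}
    (h : ∃ b : Module.Basis (Fin (n + 1)) ℝ V,
      ∀ i j, B (b i) (b j) = if i = j then (if i = 0 then -1 else 1) else 0)
    {u v : V} (hu : B u u = 0) (hv : B v v = 0) (huv : B u v = 0) (hu0 : u ≠ 0) :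
    ∃ c : ℝ, v = c • u := by
  obtain ⟨b, hb⟩ := h
  rw [lorentz_apply_eq_sum hb] at hu hv huv
  have key : ∀ w : V, B w w = 0 → b.repr w 0 = 0 → w = 0 := by
    intro w hw hw0
    rw [lorentz_apply_eq_sum hb, hw0] at hw
    have hs : ∑ i : Fin n, b.repr w i.succ * b.repr w i.succ = 0 := by linarith
    rw [Finset.sum_eq_zero_iff_of_nonneg (fun i _ => mul_self_nonneg _)] at hs
    refine b.repr.map_eq_zero_iff.1 (Finsupp.ext fun i => ?_)
    refine Fin.cases hw0 (fun j => ?_) i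
    simpa using hs j (Finset.mem_univ _)
  have hu00 : b.repr u 0 ≠ 0 := fun h0 =>
    hu0 (key u (by rw [lorentz_apply_eq_sum hb]; exact hu) h0)
  -- The factor cancels the time component of v. The difference is still null, because u and v are
  -- null and orthogonal, so `key` applies.
  refine ⟨b.repr v 0 / b.repr u 0, sub_eq_zero.1 (key _ ?_ ?_)⟩
  · rw [← lorentz_apply_eq_sum hb] at hu hv huv
    have hvu : B v u = 0 := by
      rw [lorentz_apply_eq_sum hb] at huv ⊢
      simpa [mul_comm] using huv
    simp [hu, hv, huv, hvu]
  · simp [hu00]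

/-- A Lorentzian scalar product is nondegenerate. -/
theorem eq_zero_of_lorentz_apply_eq_zero {n : ℕ} {B : V →L[ℝ] V →L[ℝ] ℝ}
    (h : ∃ b : Module.Basis (Fin (n + 1)) ℝ V,
      ∀ i j, B (b i) (b j) = if i = j then (if i = 0 then -1 else 1) else 0)
    {v : V} (hv : ∀ w, B v w = 0) : v = 0 := by
  obtain ⟨b, hb⟩ := h
  refine b.repr.map_eq_zero_iff.1 (Finsupp.ext fun i => ?_)
  have := hv (b i)
  rw [lorentz_apply_eq_sum hb] at this
  refine Fin.cases (fun h => ?_) (fun j h => ?_) i this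
  · simpa [Finsupp.single_apply, Fin.succ_ne_zero] using h
  · simpa [Finsupp.single_apply, Fin.succ_ne_zero, (Fin.succ_ne_zero _).symm] using h

/-- The size of a linearly independent family of endomorphisms which are antisymmetric for a
scalar product and map the hyperplane `k^⊥ = ker F` to the line of `k`. -/
theorem card_add_one_le_finrank_of_antisymm [FiniteDimensional ℝ V] {m : ℕ}
    {G : V →L[ℝ] V →L[ℝ] ℝ}
    (hsymm : ∀ v w, G v w = G w v) {k : V} {F : V →L[ℝ] ℝ}
    (hk0 : ∃ l, G k l ≠ 0) (hF : ∀ v, F v = 0 → G k v = 0) (hFk : F k = 0)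
    {Z : Fin m → V →L[ℝ] V} (hZ : ∀ i v w, G (Z i v) w + G v (Z i w) = 0)
    (hZF : ∀ i v, F v = 0 → ∃ c : ℝ, Z i v = c • k)
    (hLI : ∀ c : Fin m → ℝ, (∀ v, ∑ i, c i • Z i v = 0) → ∀ i, c i = 0) :
    m + 1 ≤ Module.finrank ℝ V ∧
      ((∀ i v, G k (Z i v) = 0) → m + 2 ≤ Module.finrank ℝ V) := by
  obtain ⟨l, hl⟩ := hk0
  have hFl : F l ≠ 0 := fun h => hl (hF l h)
  -- A combination W with W l = 0 vanishes: on ker F it takes values in the line of k, antisymmetry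
  -- makes these orthogonal to l, and k is not; l and ker F span.
  have hZl : LinearIndependent ℝ fun i => Z i l := by
    rw [Fintype.linearIndependent_iff]
    intro c hc
    refine hLI c fun v => ?_
    set W : V → V := fun v => ∑ i, c i • Z i v with hW
    have hWF : ∀ v, F v = 0 → W v = 0 := by
      intro v hv
      choose d hd using fun i => hZF i v hv
      have hWv : W v = (∑ i, c i * d i) • k := by
        simp only [hW, hd, smul_smul, Finset.sum_smul]
      have h1 : G (W v) l + G v (W l) = 0 := by
        simp only [hW, map_sum, map_smul, sum_apply, smul_apply, smul_eq_mul]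
        rw [← Finset.sum_add_distrib]
        refine Finset.sum_eq_zero fun i _ => ?_
        rw [← mul_add, hZ, mul_zero]
      rw [show W l = 0 from hc, map_zero, add_zero, hWv, map_smul, smul_apply, smul_eq_mul] at h1
      rw [hWv, (mul_eq_zero.1 h1).resolve_right hl, zero_smul]
    have hWlin : W v = W (v - (F v / F l) • l) + (F v / F l) • W l := by
      simp only [hW, map_sub, map_smul, smul_sub, Finset.sum_sub_distrib, Finset.smul_sum]
      rw [sub_add_eq_add_sub, eq_comm, sub_eq_iff_eq_add]
      congr 1
      exact Finset.sum_congr rfl fun i _ => smul_comm _ _ _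
    change W v = 0
    rw [hWlin, hWF _ (by simp [hFl]), show W l = 0 from hc, smul_zero, add_zero]
  -- By antisymmetry every Z i l is orthogonal to l.
  have hkm : k ∉ Submodule.span ℝ (range fun i => Z i l) := by
    intro hmem
    have hle : Submodule.span ℝ (range fun i => Z i l) ≤ LinearMap.ker (G l).toLinearMap := by
      rw [Submodule.span_le]
      rintro _ ⟨i, rfl⟩
      have := hZ i l l
      rw [hsymm] at this
      change G l (Z i l) = 0
      linarith
    have h0 : G l k = 0 := hle hmem
    exact hl (by rw [hsymm, h0])
  have hLI1 : LinearIndependent ℝ (Fin.cons k fun i => Z i l : Fin (m + 1) → V) :=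
    linearIndependent_finCons.2 ⟨hZl, hkm⟩
  refine ⟨by simpa using hLI1.fintype_card_le_finrank, fun hdeg => ?_⟩
  -- In the degenerate case all these vectors are orthogonal to k, and l is not.
  have hlm : l ∉ Submodule.span ℝ (range (Fin.cons k fun i => Z i l : Fin (m + 1) → V)) := by
    intro hmem
    have hle : Submodule.span ℝ (range (Fin.cons k fun i => Z i l : Fin (m + 1) → V))
        ≤ LinearMap.ker (G k).toLinearMap := by
      rw [Submodule.span_le]
      rintro _ ⟨i, rfl⟩
      exact Fin.cases (hF k hFk) (fun j => hdeg j l) i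
    exact hl (hle hmem)
  have hLI2 : LinearIndependent ℝ
      (Fin.cons l (Fin.cons k fun i => Z i l : Fin (m + 1) → V) : Fin (m + 2) → V) :=
    linearIndependent_finCons.2 ⟨hLI1, hlm⟩
  have h2 := hLI2.fintype_card_le_finrank
  rwa [Fintype.card_fin] at h2

end LinearAlgebra

/-! ### The metric and vector fields in a chart -/

namespace Spacetime

variable {n : ℕ} (S : Spacetime.{u} n)

local notation "𝔼" => EuclideanSpace ℝ (Fin (n + 1))

/-- The inverse of the preferred chart at `p`. -/
def chartInv (p : S.Pt) : EuclideanSpace ℝ (Fin (n + 1)) → S.Pt :=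
  (extChartAt (𝓡 (n + 1)) p).symm

/-- The coordinate frame of the chart at `p`, at the point `x`. -/
def chartFrame (p x : S.Pt) : EuclideanSpace ℝ (Fin (n + 1)) →L[ℝ] S.Tangent x :=
  (mfderiv (𝓡 (n + 1)) 𝓘(ℝ, EuclideanSpace ℝ (Fin (n + 1))) (extChartAt (𝓡 (n + 1)) p) x).inverse

/-- The domain of the coordinates of the chart at `p`. -/
def chartTarget (p : S.Pt) : Set (EuclideanSpace ℝ (Fin (n + 1))) :=
  (extChartAt (𝓡 (n + 1)) p).target

/-- The metric in the chart at `p`. -/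
def localMetric (p : S.Pt) (z : EuclideanSpace ℝ (Fin (n + 1))) :
    EuclideanSpace ℝ (Fin (n + 1)) →L[ℝ] EuclideanSpace ℝ (Fin (n + 1)) →L[ℝ] ℝ :=
  let A : EuclideanSpace ℝ (Fin (n + 1)) →L[ℝ] EuclideanSpace ℝ (Fin (n + 1)) :=
    S.chartFrame p (S.chartInv p z)
  ContinuousLinearMap.bilinearComp (E := EuclideanSpace ℝ (Fin (n + 1)))
    (F := EuclideanSpace ℝ (Fin (n + 1))) (S.metric.inner (S.chartInv p z)) A A

/-- A vector field in the chart at `p`. -/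
def localField (p : S.Pt) (ξ : S.SmoothVectorField) (z : EuclideanSpace ℝ (Fin (n + 1))) :
    EuclideanSpace ℝ (Fin (n + 1)) :=
  VectorField.mpullback 𝓘(ℝ, EuclideanSpace ℝ (Fin (n + 1))) (𝓡 (n + 1)) (S.chartInv p)
    (fun y => ξ y) z

variable {S} {p : S.Pt} {z : EuclideanSpace ℝ (Fin (n + 1))}

theorem localMetric_apply (v w : 𝔼) : S.localMetric p z v w =
    S.g (S.chartInv p z) (S.chartFrame p (S.chartInv p z) v)
      (S.chartFrame p (S.chartInv p z) w) := rfl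

theorem isOpen_chartTarget (p : S.Pt) : IsOpen (S.chartTarget p) :=
  isOpen_extChartAt_target p

theorem chartInv_mem_source (hz : z ∈ S.chartTarget p) :
    S.chartInv p z ∈ (extChartAt (𝓡 (n + 1)) p).source :=
  (extChartAt (𝓡 (n + 1)) p).map_target hz

theorem contMDiffOn_chartInv (p : S.Pt) :
    ContMDiffOn 𝓘(ℝ, 𝔼) (𝓡 (n + 1)) ∞ (S.chartInv p) (S.chartTarget p) :=
  contMDiffOn_extChartAt_symm p

theorem contMDiffAt_chartInv (hz : z ∈ S.chartTarget p) :
    ContMDiffAt 𝓘(ℝ, 𝔼) (𝓡 (n + 1)) ∞ (S.chartInv p) z :=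
  (contMDiffOn_chartInv p).contMDiffAt ((isOpen_chartTarget p).mem_nhds hz)

theorem isInvertible_mfderiv_chart {x : S.Pt} (hx : x ∈ (extChartAt (𝓡 (n + 1)) p).source) :
    (mfderiv (𝓡 (n + 1)) 𝓘(ℝ, 𝔼) (extChartAt (𝓡 (n + 1)) p) x).IsInvertible :=
  isInvertible_mfderiv_extChartAt hx

theorem mfderiv_chartInv_eq (hz : z ∈ S.chartTarget p) :
    mfderiv 𝓘(ℝ, 𝔼) (𝓡 (n + 1)) (S.chartInv p) z = S.chartFrame p (S.chartInv p z) := by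
  have h1 := mfderiv_extChartAt_comp_mfderivWithin_extChartAt_symm (I := 𝓡 (n + 1)) hz
  have h2 := mfderivWithin_extChartAt_symm_comp_mfderiv_extChartAt (I := 𝓡 (n + 1)) hz
  simp only [ModelWithCorners.range_eq_univ, mfderivWithin_univ] at h1 h2
  exact (ContinuousLinearMap.inverse_eq h1 h2).symm

theorem isInvertible_chartFrame (hz : z ∈ S.chartTarget p) :
    (S.chartFrame p (S.chartInv p z)).IsInvertible :=
  (isInvertible_mfderiv_chart (chartInv_mem_source hz)).inverse

theorem chartFrame_localField (hz : z ∈ S.chartTarget p) (ξ : S.SmoothVectorField) :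
    S.chartFrame p (S.chartInv p z) (S.localField p ξ z) = ξ (S.chartInv p z) := by
  rw [localField, VectorField.mpullback_apply, mfderiv_chartInv_eq hz]
  exact (isInvertible_chartFrame hz).self_apply_inverse _

theorem chartFrame_injective (hz : z ∈ S.chartTarget p) :
    Function.Injective (S.chartFrame p (S.chartInv p z)) :=
  (isInvertible_chartFrame hz).bijective.1

theorem chartFrame_surjective (hz : z ∈ S.chartTarget p) :
    Function.Surjective (S.chartFrame p (S.chartInv p z)) :=
  (isInvertible_chartFrame hz).bijective.2

theorem contDiffOn_localField (p : S.Pt) (ξ : S.SmoothVectorField) :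
    ContDiffOn ℝ ∞ (S.localField p ξ) (S.chartTarget p) := by
  intro z hz
  have h := ContMDiffAt.mpullback_vectorField_preimage (m := ∞) (n := ∞) (ξ.contMDiff (S.chartInv p z))
    (contMDiffAt_chartInv hz) (by rw [mfderiv_chartInv_eq hz]; exact isInvertible_chartFrame hz)
    (by simp)
  have := contMDiffAt_vectorSpace_iff_contDiffAt.1 h
  exact this.contDiffWithinAt

/-- The coordinate vector fields are smooth. -/
theorem contMDiffAt_chartFrame {x : S.Pt} (hx : x ∈ (extChartAt (𝓡 (n + 1)) p).source) (v : 𝔼) :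
    ContMDiffAt (𝓡 (n + 1)) (𝓡 (n + 1)).tangent ∞
      (fun y => (⟨y, S.chartFrame p y v⟩ : TangentBundle (𝓡 (n + 1)) S.Pt)) x := by
  have hc : ContMDiffAt 𝓘(ℝ, 𝔼) 𝓘(ℝ, 𝔼).tangent ∞
      (fun y => (⟨y, v⟩ : TangentBundle 𝓘(ℝ, 𝔼) 𝔼)) (extChartAt (𝓡 (n + 1)) p x) :=
    contMDiffAt_vectorSpace_iff_contDiffAt.2 contDiffAt_const
  exact ContMDiffAt.mpullback_vectorField_preimage (m := ∞) (n := ∞) hc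
    (contMDiffAt_extChartAt' (by simpa using hx)) (isInvertible_mfderiv_chart hx) (by simp)

/-- In finite dimension, smoothness of a form-valued map can be tested on constant vectors, where it
becomes smoothness of the metric on coordinate fields. -/
theorem contDiffOn_localMetric (p : S.Pt) :
    ContDiffOn ℝ ∞ (S.localMetric p) (S.chartTarget p) := by
  rw [contDiffOn_clm_apply]
  intro v
  rw [contDiffOn_clm_apply]
  intro w z hz
  have hφ := contMDiffAt_chartInv hz
  have h1 := (S.metric.contMDiff (S.chartInv p z)).comp z hφ
  have h2 (v : 𝔼) := (contMDiffAt_chartFrame (chartInv_mem_source hz) v).comp z hφ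
  have h3 := ContMDiffAt.clm_bundle_apply₂ (F₃ := ℝ) (E₃ := Bundle.Trivial S.Pt ℝ)
    (b := S.chartInv p) h1 (h2 v) (h2 w)
  rw [contMDiffAt_totalSpace] at h3
  exact (contMDiffAt_iff_contDiffAt.1 h3.2).contDiffWithinAt

theorem fderiv_comp_chartInv {f : S.Pt → ℝ} (hz : z ∈ S.chartTarget p)
    (hf : MDifferentiableAt (𝓡 (n + 1)) 𝓘(ℝ, ℝ) f (S.chartInv p z)) (v : 𝔼) :
    fderiv ℝ (fun y => f (S.chartInv p y)) z v =
      S.dirDeriv f (S.chartInv p z) (S.chartFrame p (S.chartInv p z) v) := by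
  have h := mfderiv_comp z hf ((contMDiffAt_chartInv hz).mdifferentiableAt (by simp))
  rw [mfderiv_chartInv_eq hz] at h
  rw [← mfderiv_eq_fderiv]
  exact congrArg (fun L => L v) h

end Spacetime

/-! ### The Killing equation in coordinates and rigidity of Killing fields -/

namespace Spacetime

variable {n : ℕ} {S : Spacetime.{u} n}

local notation "𝔼" => EuclideanSpace ℝ (Fin (n + 1))

variable {p : S.Pt} {z : EuclideanSpace ℝ (Fin (n + 1))}

theorem contMDiffAt_metric_apply {x : S.Pt} {Y Z : (y : S.Pt) → TangentSpace (𝓡 (n + 1)) y}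
    (hY : ContMDiffAt (𝓡 (n + 1)) (𝓡 (n + 1)).tangent ∞
      (fun y => (⟨y, Y y⟩ : TangentBundle (𝓡 (n + 1)) S.Pt)) x)
    (hZ : ContMDiffAt (𝓡 (n + 1)) (𝓡 (n + 1)).tangent ∞
      (fun y => (⟨y, Z y⟩ : TangentBundle (𝓡 (n + 1)) S.Pt)) x) :
    ContMDiffAt (𝓡 (n + 1)) 𝓘(ℝ, ℝ) ∞ (fun y => S.g y (Y y) (Z y)) x := by
  have h3 := ContMDiffAt.clm_bundle_apply₂ (F₃ := ℝ) (E₃ := Bundle.Trivial S.Pt ℝ)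
    (b := fun y => y) (S.metric.contMDiff x) hY hZ
  rw [contMDiffAt_totalSpace] at h3
  exact h3.2

theorem minSmoothness_two_le : minSmoothness ℝ 2 ≤ ∞ := by
  rw [minSmoothness_of_isRCLikeNormedField]
  norm_cast

instance (S : Spacetime.{u} n) : IsManifold (𝓡 (n + 1)) (minSmoothness ℝ 2) S.Pt :=
  IsManifold.of_le minSmoothness_two_le

theorem g_add_left (x : S.Pt) (u v w : S.Tangent x) : S.g x (u + v) w = S.g x u w + S.g x v w := by
  change S.metric.inner x (u + v) w = _
  rw [map_add]
  rfl

theorem g_smul_left (x : S.Pt) (c : ℝ) (v w : S.Tangent x) : S.g x (c • v) w = c * S.g x v w := by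
  change S.metric.inner x (c • v) w = _
  rw [map_smul]
  rfl

theorem g_zero_left (x : S.Pt) (w : S.Tangent x) : S.g x 0 w = 0 := by
  change S.metric.inner x 0 w = _
  rw [map_zero]
  rfl

theorem g_comm (x : S.Pt) (v w : S.Tangent x) : S.g x v w = S.g x w v :=
  S.metric.symm x v w

theorem g_add_right (x : S.Pt) (u v w : S.Tangent x) :
    S.g x u (v + w) = S.g x u v + S.g x u w := by
  rw [g_comm, g_add_left, g_comm x v, g_comm x w]

theorem g_smul_right (x : S.Pt) (c : ℝ) (v w : S.Tangent x) :
    S.g x v (c • w) = c * S.g x v w := by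
  rw [g_comm, g_smul_left, g_comm]

theorem g_zero_right (x : S.Pt) (w : S.Tangent x) : S.g x w 0 = 0 := by
  rw [g_comm, g_zero_left]

theorem dirDeriv_add (f : S.Pt → ℝ) (x : S.Pt) (v w : S.Tangent x) :
    S.dirDeriv f x (v + w) = S.dirDeriv f x v + S.dirDeriv f x w :=
  map_add (mfderiv (𝓡 (n + 1)) 𝓘(ℝ, ℝ) f x) v w

theorem dirDeriv_smul (f : S.Pt → ℝ) (x : S.Pt) (c : ℝ) (v : S.Tangent x) :
    S.dirDeriv f x (c • v) = c * S.dirDeriv f x v :=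
  map_smul (mfderiv (𝓡 (n + 1)) 𝓘(ℝ, ℝ) f x) c v

theorem dirDeriv_zero (f : S.Pt → ℝ) (x : S.Pt) : S.dirDeriv f x 0 = 0 :=
  map_zero (mfderiv (𝓡 (n + 1)) 𝓘(ℝ, ℝ) f x)

theorem mlieBracket_eq_lieBracket (V W : EuclideanSpace ℝ (Fin (n + 1)) → EuclideanSpace ℝ (Fin (n + 1)))
    (z : EuclideanSpace ℝ (Fin (n + 1))) :
    VectorField.mlieBracket 𝓘(ℝ, EuclideanSpace ℝ (Fin (n + 1))) V W z =
      fderiv ℝ W z (V z) - fderiv ℝ V z (W z) := by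
  have h := congrFun (VectorField.mlieBracketWithin_eq_lieBracketWithin (𝕜 := ℝ) (V := V) (W := W)
    (s := univ)) z
  rw [VectorField.lieBracketWithin_univ] at h
  exact (congrFun VectorField.mlieBracketWithin_univ.symm z).trans h

/-- Brackets commute with pullback, and in the chart the coordinate field is constant, so only the
derivative of ξ survives. -/
theorem mlieBracket_chartFrame (ξ : S.SmoothVectorField) (hz : z ∈ S.chartTarget p) (v : 𝔼) :
    VectorField.mlieBracket (𝓡 (n + 1)) (fun y => ξ y) (fun y => S.chartFrame p y v)
      (S.chartInv p z) =
      S.chartFrame p (S.chartInv p z) (-(fderiv ℝ (S.localField p ξ) z v)) := by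
  have h := VectorField.mpullback_mlieBracket (I := 𝓘(ℝ, 𝔼)) (I' := 𝓡 (n + 1)) (n := ∞)
    (f := S.chartInv p) (x₀ := z) (V := fun y => ξ y) (W := fun y => S.chartFrame p y v)
    ((ξ.contMDiff (S.chartInv p z)).mdifferentiableAt (by simp))
    ((contMDiffAt_chartFrame (chartInv_mem_source hz) v).mdifferentiableAt (by simp))
    (contMDiffAt_chartInv hz) minSmoothness_two_le
  have hev : VectorField.mpullback 𝓘(ℝ, 𝔼) (𝓡 (n + 1)) (S.chartInv p)
      (fun y => S.chartFrame p y v) =ᶠ[𝓝 z] fun _ => v := by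
    filter_upwards [(isOpen_chartTarget p).mem_nhds hz] with y hy
    rw [VectorField.mpullback_apply, mfderiv_chartInv_eq hy]
    exact (isInvertible_chartFrame hy).inverse_apply_self v
  have hb : VectorField.mlieBracket 𝓘(ℝ, 𝔼) (S.localField p ξ)
      (VectorField.mpullback 𝓘(ℝ, 𝔼) (𝓡 (n + 1)) (S.chartInv p) (fun y => S.chartFrame p y v)) z
      = -(fderiv ℝ (S.localField p ξ) z v) := by
    refine (Filter.EventuallyEq.mlieBracket_vectorField_eq (Filter.EventuallyEq.refl _ _)
      hev).trans ((mlieBracket_eq_lieBracket _ _ _).trans ?_)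
    simp only [hasFDerivAt_const v z |>.fderiv, zero_apply, zero_sub]
    rfl
  change _ = VectorField.mlieBracket 𝓘(ℝ, 𝔼) (S.localField p ξ) _ z at h
  rw [hb, VectorField.mpullback_apply, mfderiv_chartInv_eq hz] at h
  rw [← h]
  exact ((isInvertible_chartFrame hz).self_apply_inverse _).symm

/-- The Killing equation in a chart. -/
theorem IsKilling.killingEqAt {ξ : S.SmoothVectorField} (hξ : S.IsKilling ξ)
    (hz : z ∈ S.chartTarget p) : KillingEqAt (S.localMetric p) (S.localField p ξ) z := by
  intro v w
  have hv := contMDiffAt_chartFrame (chartInv_mem_source hz) v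
  have hw := contMDiffAt_chartFrame (chartInv_mem_source hz) w
  have h := hξ (S.chartInv p z) (fun y => S.chartFrame p y v) (fun y => S.chartFrame p y w) hv hw
  rw [mlieBracket_chartFrame ξ hz, mlieBracket_chartFrame ξ hz, ← chartFrame_localField hz,
    ← fderiv_comp_chartInv hz ((contMDiffAt_metric_apply hv hw).mdifferentiableAt (by simp)),
    ← localMetric_apply, ← localMetric_apply] at h
  have hG : HasFDerivAt (S.localMetric p) (fderiv ℝ (S.localMetric p) z) z :=
    (((contDiffOn_localMetric p).contDiffAt
      ((isOpen_chartTarget p).mem_nhds hz)).differentiableAt (by simp)).hasFDerivAt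
  have hG' : HasFDerivAt (fun y => S.localMetric p y v w) _ z :=
    (hG.clm_apply (hasFDerivAt_const v z)).clm_apply (hasFDerivAt_const w z)
  have e : fderiv ℝ (fun y => S.g (S.chartInv p y) (S.chartFrame p (S.chartInv p y) v)
      (S.chartFrame p (S.chartInv p y) w)) z (S.localField p ξ z)
      = fderiv ℝ (S.localMetric p) z (S.localField p ξ z) v w := by
    change fderiv ℝ (fun y => S.localMetric p y v w) z (S.localField p ξ z) = _
    rw [hG'.fderiv]
    simp
  rw [e] at h
  simp only [map_neg, neg_apply] at h
  linarith

theorem isKilling_zero : S.IsKilling 0 := by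
  intro x Y Z hY hZ
  have h (Y : (y : S.Pt) → TangentSpace (𝓡 (n + 1)) y) :
      VectorField.mlieBracket (𝓡 (n + 1)) (fun y => (0 : S.SmoothVectorField) y) Y x = 0 :=
    congrFun (VectorField.mlieBracket_zero_left (W := Y)) x
  rw [h, h, g_zero_left, g_zero_right, ContMDiffSection.coe_zero, Pi.zero_apply, dirDeriv_zero,
    add_zero]

theorem IsKilling.add {ξ η : S.SmoothVectorField} (hξ : S.IsKilling ξ) (hη : S.IsKilling η) :
    S.IsKilling (ξ + η) := by
  intro x Y Z hY hZ
  have h (Y : (y : S.Pt) → TangentSpace (𝓡 (n + 1)) y) :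
      VectorField.mlieBracket (𝓡 (n + 1)) (fun y => (ξ + η) y) Y x =
      VectorField.mlieBracket (𝓡 (n + 1)) (fun y => ξ y) Y x +
      VectorField.mlieBracket (𝓡 (n + 1)) (fun y => η y) Y x :=
    VectorField.mlieBracket_add_left ((ξ.contMDiff x).mdifferentiableAt (by simp))
      ((η.contMDiff x).mdifferentiableAt (by simp))
  have h1 := hξ x Y Z hY hZ
  have h2 := hη x Y Z hY hZ
  rw [h, h, g_add_left, g_add_right, ContMDiffSection.coe_add, Pi.add_apply, dirDeriv_add, h1, h2]
  ring

theorem IsKilling.smul {ξ : S.SmoothVectorField} (c : ℝ) (hξ : S.IsKilling ξ) :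
    S.IsKilling (c • ξ) := by
  intro x Y Z hY hZ
  have h (Y : (y : S.Pt) → TangentSpace (𝓡 (n + 1)) y) :
      VectorField.mlieBracket (𝓡 (n + 1)) (fun y => (c • ξ) y) Y x =
      c • VectorField.mlieBracket (𝓡 (n + 1)) (fun y => ξ y) Y x :=
    VectorField.mlieBracket_const_smul_left ((ξ.contMDiff x).mdifferentiableAt (by simp))
  have h1 := hξ x Y Z hY hZ
  rw [h, h, g_smul_left, g_smul_right, ContMDiffSection.coe_smul, Pi.smul_apply, dirDeriv_smul, h1,
    mul_add]

theorem IsKilling.sum {ι : Type*} (s : Finset ι) {ξ : ι → S.SmoothVectorField}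
    (hξ : ∀ i, S.IsKilling (ξ i)) : S.IsKilling (∑ i ∈ s, ξ i) := by
  classical
  induction s using Finset.induction_on with
  | empty => exact isKilling_zero
  | insert i s hi ih => rw [Finset.sum_insert hi]; exact (hξ i).add ih

theorem localField_zero : S.localField p 0 z = 0 := by
  simp only [localField, VectorField.mpullback_apply, ContMDiffSection.coe_zero, Pi.zero_apply,
    map_zero]
  rfl

theorem localField_add (ξ η : S.SmoothVectorField) :
    S.localField p (ξ + η) z = S.localField p ξ z + S.localField p η z := by
  simp only [localField, VectorField.mpullback_apply, ContMDiffSection.coe_add, Pi.add_apply,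
    map_add]
  rfl

theorem localField_smul (c : ℝ) (ξ : S.SmoothVectorField) :
    S.localField p (c • ξ) z = c • S.localField p ξ z := by
  simp only [localField, VectorField.mpullback_apply, ContMDiffSection.coe_smul, Pi.smul_apply,
    map_smul]
  rfl

theorem localField_sum {ι : Type*} (s : Finset ι) (ξ : ι → S.SmoothVectorField) :
    S.localField p (∑ i ∈ s, ξ i) z = ∑ i ∈ s, S.localField p (ξ i) z := by
  classical
  induction s using Finset.induction_on with
  | empty => simpa using localField_zero
  | insert i s hi ih => rw [Finset.sum_insert hi, Finset.sum_insert hi, localField_add, ih]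

theorem localField_eq_zero_iff (hz : z ∈ S.chartTarget p) (ξ : S.SmoothVectorField) :
    S.localField p ξ z = 0 ↔ ξ (S.chartInv p z) = 0 := by
  rw [← chartFrame_localField hz]
  constructor
  · intro h
    rw [h, map_zero]
  · intro h
    exact chartFrame_injective hz (by rw [h, map_zero])

theorem eventually_nhds_chartInv {P : S.Pt → Prop} (hz : z ∈ S.chartTarget p)
    (h : ∀ᶠ y in 𝓝 z, P (S.chartInv p y)) : ∀ᶠ x in 𝓝 (S.chartInv p z), P x := by
  have hs := chartInv_mem_source hz
  have hc : ContinuousAt (extChartAt (𝓡 (n + 1)) p) (S.chartInv p z) :=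
    continuousAt_extChartAt' hs
  have he : extChartAt (𝓡 (n + 1)) p (S.chartInv p z) = z :=
    (extChartAt (𝓡 (n + 1)) p).right_inv hz
  have := hc.eventually (by rw [he]; exact h)
  filter_upwards [this, (isOpen_extChartAt_source p).mem_nhds hs] with x hx hxs
  have hl : S.chartInv p (extChartAt (𝓡 (n + 1)) p x) = x :=
    (extChartAt (𝓡 (n + 1)) p).left_inv hxs
  rwa [hl] at hx

theorem exists_chartInv_eq (p : S.Pt) : ∃ z ∈ S.chartTarget p, S.chartInv p z = p :=
  ⟨extChartAt (𝓡 (n + 1)) p p, mem_extChartAt_target p, extChartAt_to_inv p⟩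

theorem localMetric_symm (v w : 𝔼) : S.localMetric p z v w = S.localMetric p z w v :=
  S.metric.symm _ _ _

theorem eq_zero_of_localMetric_eq_zero (hz : z ∈ S.chartTarget p) {v : 𝔼}
    (h : ∀ w, S.localMetric p z v w = 0) : v = 0 := by
  refine chartFrame_injective hz ?_
  rw [map_zero]
  refine eq_zero_of_lorentz_apply_eq_zero
    (S.metric.exists_orthonormal_basis (S.chartInv p z)) fun w => ?_
  obtain ⟨w, rfl⟩ := chartFrame_surjective hz w
  exact h w

/-- Every point of a chart domain has a neighbourhood in which Killing fields are determined by
their first order data at any point. -/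
theorem exists_ball_killing_eq_zero (hz : z ∈ S.chartTarget p) :
    ∃ r > 0, Metric.ball z r ⊆ S.chartTarget p ∧ ∀ ξ : S.SmoothVectorField, S.IsKilling ξ →
      ∀ y ∈ Metric.ball z r, S.localField p ξ y = 0 → fderiv ℝ (S.localField p ξ) y = 0 →
        ∀ x ∈ Metric.ball z r, S.localField p ξ x = 0 := by
  obtain ⟨r, hr, hsub, h⟩ := KillingEqAt.exists_ball_eq_zero (isOpen_chartTarget p)
    ((contDiffOn_localMetric p).of_le (by norm_cast))
    (fun z _ => localMetric_symm) hz (fun v => eq_zero_of_localMetric_eq_zero hz)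
  exact ⟨r, hr, hsub, fun ξ hξ => h _ ((contDiffOn_localField p ξ).of_le
    (by norm_cast)) fun y hy => hξ.killingEqAt hy⟩

/-- A Killing field is determined by its first order data at a point. -/
theorem IsKilling.eq_zero {ξ : S.SmoothVectorField} (hξ : S.IsKilling ξ)
    (hz : z ∈ S.chartTarget p) (h0 : S.localField p ξ z = 0)
    (h1 : fderiv ℝ (S.localField p ξ) z = 0) : ξ = 0 := by
  -- Connectedness argument. N is closed because the ball around a limit point contains points of N,
  -- and vanishing to first order at any point of the ball suffices.
  set N : Set S.Pt := {x | ∀ᶠ y in 𝓝 x, ξ y = 0} with hN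
  have hopen : IsOpen N := isOpen_setOfPred_eventually_nhds
  have hclosed : IsClosed N := by
    rw [← closure_subset_iff_isClosed]
    intro x hx
    obtain ⟨z, hz, hzx⟩ := exists_chartInv_eq x
    obtain ⟨r, hr, hsub, h⟩ := exists_ball_killing_eq_zero hz
    have hev : ∀ᶠ q in 𝓝 x, ∃ y ∈ Metric.ball z r, S.chartInv x y = q := by
      have := eventually_nhds_chartInv (P := fun q => ∃ y ∈ Metric.ball z r, S.chartInv x y = q) hz
        (by filter_upwards [Metric.ball_mem_nhds z hr] with y hy using ⟨y, hy, rfl⟩)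
      rwa [hzx] at this
    obtain ⟨q, ⟨y, hy, rfl⟩, hq⟩ := (mem_closure_iff_frequently.1 hx).and_eventually hev |>.exists
      |> fun ⟨q, h1, h2⟩ => (⟨q, h2, h1⟩ :
        ∃ q, (∃ y ∈ Metric.ball z r, S.chartInv x y = q) ∧ q ∈ N)
    have hloc : S.localField x ξ =ᶠ[𝓝 y] fun _ => 0 := by
      have := ((contMDiffAt_chartInv (hsub hy)).continuousAt).eventually hq
      filter_upwards [this, Metric.isOpen_ball.mem_nhds hy] with w hw hwb
      exact (localField_eq_zero_iff (hsub hwb) ξ).2 hw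
    have hall := h ξ hξ y hy hloc.eq_of_nhds (by rw [hloc.fderiv_eq]; simp)
    filter_upwards [hev] with q hq
    obtain ⟨w, hw, rfl⟩ := hq
    exact (localField_eq_zero_iff (hsub hw) ξ).1 (hall w hw)
  have hne : N.Nonempty := by
    obtain ⟨r, hr, hsub, h⟩ := exists_ball_killing_eq_zero hz
    refine ⟨S.chartInv p z, eventually_nhds_chartInv hz ?_⟩
    filter_upwards [Metric.ball_mem_nhds z hr] with y hy
    exact (localField_eq_zero_iff (hsub hy) ξ).1
      (h ξ hξ z (Metric.mem_ball_self hr) h0 h1 y hy)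
  have huniv : N = univ := IsClopen.eq_univ ⟨hclosed, hopen⟩ hne
  ext x
  have hx : x ∈ N := huniv ▸ mem_univ x
  rw [hx.self_of_nhds]
  simp

end Spacetime

/-! ### Null hypersurfaces and the upper bounds -/

namespace Spacetime

variable {n : ℕ} {S : Spacetime.{u} n}

local notation "𝔼" => EuclideanSpace ℝ (Fin (n + 1))

variable {p : S.Pt} {z : EuclideanSpace ℝ (Fin (n + 1))}

theorem IsDefiningFunction.contMDiffAt {H : Set S.Pt} {q : S.Pt} {U : Set S.Pt} {f : S.Pt → ℝ}
    (h : S.IsDefiningFunction H q U f) : ContMDiffAt (𝓡 (n + 1)) 𝓘(ℝ, ℝ) ∞ f q :=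
  h.contMDiffOn.contMDiffAt (h.isOpen.mem_nhds h.mem)

theorem contDiffAt_comp_chartInv {f : S.Pt → ℝ} (hz : z ∈ S.chartTarget p)
    (hf : ContMDiffAt (𝓡 (n + 1)) 𝓘(ℝ, ℝ) ∞ f (S.chartInv p z)) :
    ContDiffAt ℝ ∞ (fun y => f (S.chartInv p y)) z :=
  contMDiffAt_iff_contDiffAt.1 (hf.comp z (contMDiffAt_chartInv hz))

/-- A hypersurface is relatively open in its closure. -/
theorem IsHypersurface.exists_isOpen {K : Set S.Pt} (hK : S.IsHypersurface K) :
    ∃ W, IsOpen W ∧ K = W ∩ closure K := by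
  refine ⟨⋃₀ {W | IsOpen W ∧ W ∩ closure K ⊆ K}, isOpen_sUnion fun W hW => hW.1, ?_⟩
  refine Subset.antisymm (fun p hp => ⟨?_, subset_closure hp⟩) ?_
  · obtain ⟨U, f, hf⟩ := hK p hp
    refine mem_sUnion.2 ⟨U, ⟨hf.isOpen, ?_⟩, hf.mem⟩
    rintro q ⟨hqU, hq⟩
    have hfq : ContinuousAt f q :=
      hf.contMDiffOn.continuousOn.continuousAt (hf.isOpen.mem_nhds hqU)
    have hfq0 : f q = 0 := by
      by_contra h0
      have h1 : ∀ᶠ x in 𝓝 q, f x ≠ 0 ∧ x ∈ U :=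
        (hfq.eventually_ne h0).and (hf.isOpen.mem_nhds hqU)
      obtain ⟨x, hxK, hx0, hxU⟩ := ((mem_closure_iff_frequently.1 hq).and_eventually h1).exists
      have : x ∈ {q ∈ U | f q = 0} := hf.inter_eq ▸ ⟨hxK, hxU⟩
      exact hx0 this.2
    have : q ∈ K ∩ U := hf.inter_eq ▸ ⟨hqU, hfq0⟩
    exact this.1
  · rintro q ⟨hq, hqc⟩
    obtain ⟨W, ⟨-, hW⟩, hqW⟩ := mem_sUnion.1 hq
    exact hW ⟨hqW, hqc⟩

/-- Finitely many hypersurfaces with the same non-empty closure coincide near a common point. -/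
theorem exists_common_point {ι : Type*} [Finite ι] {K : ι → Set S.Pt} {C : Set S.Pt}
    (hC : C.Nonempty) (hK : ∀ i, S.IsHypersurface (K i)) (hKC : ∀ i, closure (K i) = C) :
    ∃ p W, IsOpen W ∧ p ∈ W ∧ p ∈ C ∧ ∀ i, K i ∩ W = C ∩ W := by
  classical
  cases nonempty_fintype ι
  choose W hWo hW using fun i => (hK i).exists_isOpen
  -- Each W i ∩ C equals K i, hence is open and dense in C; finitely many such sets meet.
  have key : ∀ s : Finset ι, ((⋂ i ∈ s, W i) ∩ C).Nonempty := by
    intro s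
    induction s using Finset.induction_on with
    | empty => simpa using hC
    | insert i s hi ih =>
      obtain ⟨q, hqs, hqC⟩ := ih
      have hopen : IsOpen (⋂ i ∈ s, W i) := isOpen_biInter_finset fun i _ => hWo i
      rw [← hKC i] at hqC
      obtain ⟨x, hx, hxK⟩ := mem_closure_iff.1 hqC _ hopen hqs
      refine ⟨x, ?_, hKC i ▸ subset_closure hxK⟩
      rw [Finset.set_biInter_insert]
      rw [hW i] at hxK
      exact ⟨hxK.1, hx⟩
  obtain ⟨p, hpW, hpC⟩ := key Finset.univ
  refine ⟨p, ⋂ i, W i, isOpen_iInter_of_finite hWo, by simpa using hpW, hpC, fun i => ?_⟩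
  conv_lhs => rw [hW i, hKC i]
  ext x
  simp only [mem_inter_iff, mem_iInter]
  exact ⟨fun h => ⟨h.1.2, h.2⟩, fun h => ⟨⟨h.2 i, h.1⟩, h.2⟩⟩

theorem IsDefiningFunction.congr {H H' W : Set S.Pt} {q : S.Pt} {U : Set S.Pt} {f : S.Pt → ℝ}
    (h : S.IsDefiningFunction H q U f) (hW : IsOpen W) (hq : q ∈ W) (hH : H ∩ W = H' ∩ W) :
    S.IsDefiningFunction H' q (U ∩ W) f where
  isOpen := h.isOpen.inter hW
  mem := ⟨h.mem, hq⟩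
  contMDiffOn := h.contMDiffOn.mono inter_subset_left
  deriv_ne_zero := fun x hx => h.deriv_ne_zero x hx.1
  inter_eq := by
    ext x
    have h1 : x ∈ H ∩ U ↔ x ∈ {q ∈ U | f q = 0} := by rw [h.inter_eq]
    have h2 : x ∈ H ∩ W ↔ x ∈ H' ∩ W := by rw [hH]
    simp only [mem_inter_iff, mem_ofPred_eq] at h1 h2 ⊢
    tauto

/-- Tangency to a hypersurface only depends on the hypersurface near the point. -/
theorem IsTangentTo.congr {H H' W : Set S.Pt} {q : S.Pt} {v : S.Tangent q}
    (h : S.IsTangentTo H q v) (hW : IsOpen W) (hq : q ∈ W) (hH : H ∩ W = H' ∩ W) :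
    S.IsTangentTo H' q v :=
  fun _ f hf => h _ f (hf.congr hW hq hH.symm)

/-- The derivative of a function vanishing on a hypersurface vanishes on tangent vectors. -/
theorem IsDefiningFunction.dirDeriv_eq_zero {H : Set S.Pt} {q : S.Pt} {U : Set S.Pt}
    {f : S.Pt → ℝ} (hf : S.IsDefiningFunction H q U f) (hq : q ∈ H) {φ : S.Pt → ℝ}
    (hφ : ContMDiffAt (𝓡 (n + 1)) 𝓘(ℝ, ℝ) ∞ φ q) (h : ∀ᶠ x in 𝓝 q, x ∈ H → φ x = 0)
    {v : S.Tangent q} (hv : S.dirDeriv f q v = 0) : S.dirDeriv φ q v = 0 := by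
  obtain ⟨p, z, hz, rfl⟩ : ∃ p z, z ∈ S.chartTarget p ∧ S.chartInv p z = q :=
    ⟨q, exists_chartInv_eq q⟩
  obtain ⟨v, rfl⟩ := chartFrame_surjective hz v
  have hf1 := hf.contMDiffAt
  rw [← fderiv_comp_chartInv hz (hf1.mdifferentiableAt (by simp))] at hv
  rw [← fderiv_comp_chartInv hz (hφ.mdifferentiableAt (by simp))]
  have hcont := (contMDiffAt_chartInv hz).continuousAt
  refine fderiv_eq_zero_of_eventually_zero_on_level
    ((contDiffAt_comp_chartInv hz hf1).of_le (by norm_cast))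
    ((contDiffAt_comp_chartInv hz hφ).of_le (by norm_cast)) ?_ ?_ ?_ hv
  · have : S.chartInv p z ∈ {q ∈ U | f q = 0} := hf.inter_eq ▸ ⟨hq, hf.mem⟩
    exact this.2
  · obtain ⟨w, hw⟩ := hf.deriv_ne_zero _ hf.mem
    obtain ⟨w, rfl⟩ := chartFrame_surjective hz w
    intro h0
    rw [← fderiv_comp_chartInv hz (hf1.mdifferentiableAt (by simp)), h0] at hw
    exact hw rfl
  · filter_upwards [hcont.eventually h, hcont.eventually (hf.isOpen.mem_nhds hf.mem)]
      with y hy hyU hy0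
    have : S.chartInv p y ∈ H ∩ U := hf.inter_eq ▸ ⟨hyU, hy0⟩
    exact hy this.1

/-- Any other defining function vanishes on H near q, so its differential vanishes on the kernel of
the given one; one function therefore tests tangency. -/
theorem IsDefiningFunction.isTangentTo_iff {H : Set S.Pt} {q : S.Pt} {U : Set S.Pt}
    {f : S.Pt → ℝ} (hf : S.IsDefiningFunction H q U f) (hq : q ∈ H) {v : S.Tangent q} :
    S.IsTangentTo H q v ↔ S.dirDeriv f q v = 0 := by
  refine ⟨fun h => h U f hf, fun hv U' f' hf' => hf.dirDeriv_eq_zero hq hf'.contMDiffAt ?_ hv⟩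
  filter_upwards [hf'.isOpen.mem_nhds hf'.mem] with x hxU hx
  have : x ∈ {q ∈ U' | f' q = 0} := hf'.inter_eq ▸ ⟨hx, hxU⟩
  exact this.2

/-- At a point of a null hypersurface, the null tangent vectors span a line, which is orthogonal
to the tangent space. -/
theorem IsNullHypersurface.null_tangent {K : Set S.Pt} (hK : S.IsNullHypersurface K) {q : S.Pt}
    (hq : q ∈ K) {u : S.Tangent q} (hu : S.IsTangentTo K q u) (hu0 : u ≠ 0) (huu : S.g q u u = 0) :
    (∀ v, S.IsTangentTo K q v → S.g q u v = 0) ∧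
      ∀ v, S.IsTangentTo K q v → S.g q v v = 0 → ∃ c : ℝ, v = c • u := by
  obtain ⟨k, hk0, hk, hkv⟩ := hK.2 q hq
  have hprop : ∀ v, S.IsTangentTo K q v → S.g q v v = 0 → ∃ c : ℝ, v = c • k := fun v hv hvv =>
    exists_eq_smul_of_null_of_orthogonal (S.metric.exists_orthonormal_basis q) (hkv k hk) hvv
      (hkv v hv) hk0
  obtain ⟨c, rfl⟩ := hprop u hu huu
  have hc : c ≠ 0 := by
    rintro rfl
    simp at hu0
  refine ⟨fun v hv => by rw [g_smul_left, hkv v hv, mul_zero], fun v hv hvv => ?_⟩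
  obtain ⟨d, rfl⟩ := hprop v hv hvv
  exact ⟨d / c, by rw [smul_smul, div_mul_cancel₀ _ hc]⟩

/-- The number of linearly independent Killing fields with Killing horizons of the same closure. -/
theorem card_le_of_isKillingHorizon {m : ℕ} {ξ : Fin (m + 1) → S.SmoothVectorField}
    (hLI : LinearIndependent ℝ ξ) {K : Fin (m + 1) → Set S.Pt} {C : Set S.Pt} (hC : C.Nonempty)
    (hK : ∀ i, S.IsKillingHorizon (ξ i) (K i)) (hKC : ∀ i, closure (K i) = C) :
    m + 1 ≤ n + 1 ∧ ((∀ i, S.IsSurfaceGravity (ξ i) (K i) 0) → m + 2 ≤ n + 1) := by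
  obtain ⟨p₀, W, hW, hpW, hpC, hKW⟩ := exists_common_point hC
    (fun i => (hK i).isNullHypersurface.1) hKC
  obtain ⟨p, z, hz, rfl⟩ : ∃ p z, z ∈ S.chartTarget p ∧ S.chartInv p z = p₀ :=
    ⟨p₀, exists_chartInv_eq p₀⟩
  -- all the fields are multiples of the first one on the common part of the horizons
  have mem : ∀ i, ∀ q ∈ C ∩ W, q ∈ K i := fun i q hq => by
    rw [← hKW i] at hq
    exact hq.1
  have tangent : ∀ i, ∀ q ∈ C ∩ W, S.IsTangentTo (K 0) q (ξ i q) := fun i q hq =>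
    ((hK i).tangent q (mem i q hq)).congr hW hq.2 ((hKW i).trans (hKW 0).symm)
  have null : ∀ q ∈ C ∩ W, (∀ v, S.IsTangentTo (K 0) q v → S.g q (ξ 0 q) v = 0) ∧
      ∀ i, ∃ c : ℝ, ξ i q = c • ξ 0 q := by
    intro q hq
    have h := (hK 0).isNullHypersurface.null_tangent (mem 0 q hq) (tangent 0 q hq)
      ((hK 0).ne_zero q (mem 0 q hq)) ((hK 0).null q (mem 0 q hq))
    exact ⟨h.1, fun i => h.2 _ (tangent i q hq) ((hK i).null q (mem i q hq))⟩
  have hq : S.chartInv p z ∈ C ∩ W := ⟨hpC, hpW⟩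
  obtain ⟨U, f, hf⟩ := (hK 0).isNullHypersurface.1 _ (mem 0 _ hq)
  set G := S.localMetric p z with hG
  set X : Fin (m + 1) → 𝔼 → 𝔼 := fun i => S.localField p (ξ i) with hX
  have hXd : ∀ i, HasFDerivAt (X i) (fderiv ℝ (X i) z) z := fun i =>
    (((contDiffOn_localField p (ξ i)).contDiffAt
      ((isOpen_chartTarget p).mem_nhds hz)).differentiableAt (by simp)).hasFDerivAt
  set A : Fin (m + 1) → 𝔼 →L[ℝ] 𝔼 := fun i => fderiv ℝ (X i) z with hA
  set k := X 0 z with hk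
  set F : 𝔼 →L[ℝ] ℝ := fderiv ℝ (fun y => f (S.chartInv p y)) z with hF
  have hfd : MDifferentiableAt (𝓡 (n + 1)) 𝓘(ℝ, ℝ) f (S.chartInv p z) :=
    hf.contMDiffAt.mdifferentiableAt (by simp)
  have hFt : ∀ v, F v = 0 ↔ S.IsTangentTo (K 0) (S.chartInv p z)
      (S.chartFrame p (S.chartInv p z) v) := fun v => by
    rw [hf.isTangentTo_iff (mem 0 _ hq), ← fderiv_comp_chartInv hz hfd]
  have frame : ∀ i {y : 𝔼}, y ∈ S.chartTarget p →
      S.chartFrame p (S.chartInv p y) (X i y) = ξ i (S.chartInv p y) :=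
    fun i y hy => chartFrame_localField hy (ξ i)
  have prop : ∀ i {y : 𝔼}, y ∈ S.chartTarget p → S.chartInv p y ∈ C ∩ W →
      ∃ c : ℝ, X i y = c • X 0 y := by
    intro i y hy hyC
    obtain ⟨c, hc⟩ := (null _ hyC).2 i
    refine ⟨c, chartFrame_injective hy ?_⟩
    rw [map_smul, frame i hy, frame 0 hy, hc]
  choose a ha using fun i => prop i hz hq
  have hk0 : k ≠ 0 := by
    rw [hk, hX, Ne, localField_eq_zero_iff hz]
    exact (hK 0).ne_zero _ (mem 0 _ hq)
  have kill : ∀ i, KillingEqAt (S.localMetric p) (X i) z := fun i =>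
    (hK i).isKilling.killingEqAt hz
  -- These are the derivatives of ξ i.succ - a i.succ • ξ 0. This field vanishes at the point, so
  -- the derivative of the metric drops out of its Killing equation and Z i is antisymmetric.
  set Z : Fin m → 𝔼 →L[ℝ] 𝔼 := fun i => A i.succ - a i.succ • A 0 with hZ
  have hGnd : ∃ l, G k l ≠ 0 := by
    by_contra! h
    exact hk0 (eq_zero_of_localMetric_eq_zero hz h)
  have hZanti : ∀ i v w, G (Z i v) w + G v (Z i w) = 0 := by
    intro i v w
    have h1 := kill i.succ v w
    have h0 := kill 0 v w
    rw [ha i.succ, map_smul] at h1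
    simp only [hZ, sub_apply, smul_apply, map_sub, map_smul, smul_eq_mul] at h1 h0 ⊢
    linear_combination h1 - a i.succ * h0
  have hZF : ∀ i v, F v = 0 → ∃ c : ℝ, Z i v = c • k := by
    intro i v hv
    obtain ⟨j, hj⟩ : ∃ j, k j ≠ 0 := by
      by_contra! h
      exact hk0 (PiLp.ext h)
    -- The 2 × 2 minors of X i.succ and X 0 vanish on the horizon; their tangential derivatives give
    -- Z i v r * k j = Z i v j * k r. This avoids any regularity of the proportionality factor.
    refine ⟨Z i v j / k j, PiLp.ext fun r => ?_⟩
    have hco : ∀ (i : Fin (m + 1)) (r : Fin (n + 1)), HasFDerivAt (fun y => X i y r)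
        ((EuclideanSpace.proj (𝕜 := ℝ) r).comp (A i)) z := fun i r =>
      (EuclideanSpace.proj (𝕜 := ℝ) r).hasFDerivAt.comp z (hXd i)
    have hd := ((hco i.succ r).mul (hco 0 j)).sub ((hco i.succ j).mul (hco 0 r))
    have hX2 : ∀ i r, ContDiffAt ℝ 1 (fun y => X i y r) z := fun i r =>
      ((EuclideanSpace.proj (𝕜 := ℝ) r).contDiff.contDiffAt).comp z
        (((contDiffOn_localField p (ξ i)).contDiffAt
          ((isOpen_chartTarget p).mem_nhds hz)).of_le (by norm_cast))
    have hcont := (contMDiffAt_chartInv hz).continuousAt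
    have h0 := fderiv_eq_zero_of_eventually_zero_on_level
      (φ := fun y => X i.succ y r * X 0 y j - X i.succ y j * X 0 y r)
      ((contDiffAt_comp_chartInv hz hf.contMDiffAt).of_le (by norm_cast))
      (((hX2 _ _).mul (hX2 _ _)).sub ((hX2 _ _).mul (hX2 _ _)))
      (by
        have : S.chartInv p z ∈ {q ∈ U | f q = 0} := hf.inter_eq ▸ ⟨mem 0 _ hq, hf.mem⟩
        exact this.2)
      (by
        obtain ⟨w, hw⟩ := hf.deriv_ne_zero _ hf.mem
        obtain ⟨w, rfl⟩ := chartFrame_surjective hz w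
        intro h0
        rw [← fderiv_comp_chartInv hz hfd, h0] at hw
        exact hw rfl)
      (by
        filter_upwards [hcont.eventually (hf.isOpen.mem_nhds hf.mem),
          hcont.eventually (hW.mem_nhds hpW), (isOpen_chartTarget p).mem_nhds hz]
          with y hyU hyW hyt hy0
        have h1 : S.chartInv p y ∈ K 0 ∩ U := hf.inter_eq ▸ ⟨hyU, hy0⟩
        have h2 : S.chartInv p y ∈ C ∩ W := hKW 0 ▸ ⟨h1.1, hyW⟩
        obtain ⟨c, hc⟩ := prop i.succ hyt h2
        simp only [hc, PiLp.smul_apply, smul_eq_mul]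
        ring) hv
    have e := hd.fderiv
    have e2 := congrArg (fun L => L v) e
    change fderiv ℝ (fun y => X i.succ y r * X 0 y j - X i.succ y j * X 0 y r) z v = _ at e2
    rw [h0] at e2
    simp only [sub_apply, add_apply, smul_apply, ContinuousLinearMap.comp_apply, smul_eq_mul,
      ha i.succ, PiLp.smul_apply] at e2
    change _ = (a i.succ * k r * A 0 v j + k j * A i.succ v r)
      - (a i.succ * k j * A 0 v r + k r * A i.succ v j) at e2
    change A i.succ v r - a i.succ * A 0 v r
      = (A i.succ v j - a i.succ * A 0 v j) / k j * k r
    field_simp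
    linear_combination -e2
  have hZLI : ∀ c : Fin m → ℝ, (∀ v, ∑ i, c i • Z i v = 0) → ∀ i, c i = 0 := by
    intro c hc
    -- A relation among the Z i makes this Killing field vanish to first order at the point, hence
    -- everywhere, which is a relation among the ξ.
    set η : S.SmoothVectorField := ∑ i, c i • (ξ i.succ + (-a i.succ) • ξ 0) with hη
    have hηK : S.IsKilling η := IsKilling.sum _ fun i =>
      (((hK i.succ).isKilling).add ((hK 0).isKilling.smul _)).smul _
    have hloc : S.localField p η = fun y => ∑ i, c i • (X i.succ y + (-a i.succ) • X 0 y) := by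
      funext y
      simp only [hη, localField_sum, localField_smul, localField_add, hX]
    have hη0 : η = 0 := by
      refine hηK.eq_zero hz ?_ ?_
      · rw [hloc]
        refine Finset.sum_eq_zero fun i _ => ?_
        rw [ha i.succ, ← add_smul, add_neg_cancel, zero_smul, smul_zero]
      · have hd : HasFDerivAt (fun y => ∑ i, c i • (X i.succ y + (-a i.succ) • X 0 y))
            (∑ i, c i • (A i.succ + (-a i.succ) • A 0)) z :=
          HasFDerivAt.fun_sum fun i _ =>
            ((hXd i.succ).add ((hXd 0).const_smul (-a i.succ))).const_smul (c i)
        rw [hloc, hd.fderiv]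
        ext1 v
        rw [zero_apply, ← hc v, sum_apply]
        refine Finset.sum_congr rfl fun i _ => ?_
        simp only [hZ, smul_apply, add_apply, neg_smul, sub_eq_add_neg]
    rw [Fintype.linearIndependent_iff] at hLI
    have := hLI (Fin.cons (-∑ i, c i * a i.succ) c) (by
      rw [Fin.sum_univ_succ]
      simp only [Fin.cons_zero, Fin.cons_succ]
      rw [← hη0, hη, neg_smul, Finset.sum_smul, neg_add_eq_sub, ← Finset.sum_sub_distrib]
      refine Finset.sum_congr rfl fun i _ => ?_
      rw [smul_add, smul_smul, mul_neg, neg_smul, sub_eq_add_neg])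
    intro i
    simpa using this i.succ
  have main := card_add_one_le_finrank_of_antisymm (G := G) (k := k) (F := F) (Z := Z)
    (fun v w => localMetric_symm v w) hGnd
    (fun v hv => by
      have := (null _ hq).1 _ ((hFt v).1 hv)
      rw [← frame 0 hz] at this
      exact this)
    (by rw [hFt, hk, frame 0 hz]; exact tangent 0 _ hq) hZanti hZF hZLI
  rw [finrank_euclideanSpace_fin] at main
  refine ⟨main.1, fun hdeg => main.2 fun i v => ?_⟩
  have hGd : HasFDerivAt (S.localMetric p) (fderiv ℝ (S.localMetric p) z) z :=
    (((contDiffOn_localMetric p).contDiffAt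
      ((isOpen_chartTarget p).mem_nhds hz)).differentiableAt (by simp)).hasFDerivAt
  -- Zero surface gravity: the differential of g(ξ, ξ) vanishes at the point, written in
  -- coordinates.
  have hsg : ∀ i, fderiv ℝ (S.localMetric p) z v (X i z) (X i z) + 2 * G (X i z) (A i v) = 0 := by
    intro i
    have h1 := hdeg i _ (mem i _ hq) (S.chartFrame p (S.chartInv p z) v)
    rw [← fderiv_comp_chartInv hz ((contMDiffAt_metric_apply ((ξ i).contMDiff _)
      ((ξ i).contMDiff _)).mdifferentiableAt (by simp))] at h1
    have hev : (fun y => S.g (S.chartInv p y) (ξ i (S.chartInv p y)) (ξ i (S.chartInv p y)))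
        =ᶠ[𝓝 z] fun y => S.localMetric p y (X i y) (X i y) := by
      filter_upwards [(isOpen_chartTarget p).mem_nhds hz] with y hy
      rw [localMetric_apply, frame i hy]
    have hd := (hGd.clm_apply (hXd i)).clm_apply (hXd i)
    rw [hev.fderiv_eq, hd.fderiv] at h1
    simp at h1
    have hs := localMetric_symm (S := S) (p := p) (z := z) (A i v) (X i z)
    linear_combination h1 - hs
  have h1 := hsg i.succ
  have h0 := hsg 0
  rw [ha i.succ] at h1
  have ha0 : a i.succ ≠ 0 := by
    intro h0
    have h2 := ha i.succ
    rw [h0, zero_smul, hX, localField_eq_zero_iff hz] at h2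
    exact (hK i.succ).ne_zero _ (mem i.succ _ hq) h2
  simp only [map_smul, smul_apply, smul_eq_mul] at h1
  -- Since X i.succ z = a i.succ • k, subtracting a i.succ ^ 2 times the equation for ξ 0 removes
  -- the derivative of the metric.
  have h2 : a i.succ * (2 * (G k (A i.succ v) - a i.succ * G k (A 0 v))) = 0 := by
    linear_combination h1 - a i.succ ^ 2 * h0
  have h3 := (mul_eq_zero.1 ((mul_eq_zero.1 h2).resolve_left ha0)).resolve_left two_ne_zero
  simpa only [hZ, sub_apply, smul_apply, map_sub, map_smul, smul_eq_mul] using h3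

/-- A basis of the span can be chosen inside s, so only families of actual members of s matter, and
s need not be known to be a subspace. -/
theorem rank_span_le_of_forall_fin {V : Type u} [AddCommGroup V] [Module ℝ V] {s : Set V} {N : ℕ}
    (h : ∀ v : Fin (N + 1) → V, (∀ i, v i ∈ s) → ¬ LinearIndependent ℝ v) :
    Module.rank ℝ (Submodule.span ℝ s) ≤ N := by
  obtain ⟨b, hbs, hspan, hb⟩ := exists_linearIndependent ℝ s
  rw [← hspan, rank_span_set hb]
  by_contra! hlt
  have hle : ((N + 1 : ℕ) : Cardinal.{u}) ≤ Cardinal.mk b := by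
    rw [Nat.cast_add_one, ← Cardinal.succ_natCast]
    exact Order.succ_le_of_lt hlt
  obtain ⟨e⟩ : Nonempty (Fin (N + 1) ↪ b) := by
    rw [← Cardinal.lift_mk_le'.{0, u}]
    simpa using hle
  exact h (fun i => (e i : V)) (fun i => hbs (e i).2) (hb.comp e e.injective)

theorem IsMultipleKillingHorizon.nonempty {H : Set S.Pt} (hH : S.IsMultipleKillingHorizon H) :
    (closure H).Nonempty := by
  obtain ⟨-, m, hm, ξ, -, K, hK⟩ := hH
  have h := hK ⟨0, by omega⟩
  rw [← h.2]
  rcases h.1.connected with hc | hc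
  · exact hc.nonempty.closure
  · exact hc.nonempty.mono fun x hx => hx.1

theorem order_le {H : Set S.Pt} (hH : S.IsMultipleKillingHorizon H) :
    S.order H ≤ (n + 1 : ℕ) := by
  refine rank_span_le_of_forall_fin fun ξ hξ hLI => ?_
  have h := fun i => (hξ i).resolve_left (hLI.ne_zero i)
  choose K hK hKH using h
  have := (card_le_of_isKillingHorizon hLI hH.nonempty hK hKH).1
  omega

theorem degenerateDim_le {H : Set S.Pt} (hH : S.IsMultipleKillingHorizon H) :
    S.degenerateDim H ≤ n := by
  refine rank_span_le_of_forall_fin fun ξ hξ hLI => ?_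
  have h := fun i => (hξ i).resolve_left (hLI.ne_zero i)
  choose K hK hKH hsg using h
  -- The family has n + 1 members, so the degenerate count reads n + 2 ≤ n + 1.
  have := (card_le_of_isKillingHorizon hLI hH.nonempty hK hKH).2 hsg
  omega

theorem IsFullyDegenerate.order_le {H : Set S.Pt} (hH : S.IsMultipleKillingHorizon H)
    (hdeg : S.IsFullyDegenerate H) : S.order H ≤ n := by
  unfold order
  rw [hdeg]
  exact degenerateDim_le hH

end Spacetime

/-! ### Spacetimes on ℝⁿ⁺¹ given by a family of forms -/

section Flat

variable {n : ℕ}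

/-- The smooth Lorentzian metric on `ℝⁿ⁺¹` given by a smooth family of Lorentzian forms. -/
def lorentzMetricOfForm
    (G : EuclideanSpace ℝ (Fin (n + 1)) →
      EuclideanSpace ℝ (Fin (n + 1)) →L[ℝ] EuclideanSpace ℝ (Fin (n + 1)) →L[ℝ] ℝ)
    (hG : ContDiff ℝ ∞ G) (hsymm : ∀ x v w, G x v w = G x w v)
    (hb : ∀ x, ∃ b : Module.Basis (Fin (n + 1)) ℝ (EuclideanSpace ℝ (Fin (n + 1))),
      ∀ i j, G x (b i) (b j) = if i = j then (if i = 0 then -1 else 1) else 0) :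
    @LorentzMetric n (EuclideanSpace ℝ (Fin (n + 1))) _ (chartedSpaceSelf _)
      (instIsManifoldModelSpace (I := 𝓡 (n + 1))) where
  inner x := G x
  symm := hsymm
  exists_orthonormal_basis := hb
  contMDiff := by
    intro x
    have h : ContMDiffAt (𝓡 (n + 1)) 𝓘(ℝ, EuclideanSpace ℝ (Fin (n + 1)) →L[ℝ]
      EuclideanSpace ℝ (Fin (n + 1)) →L[ℝ] ℝ) ∞ G x := hG.contMDiff x
    refine (contMDiffAt_hom_bundle _).2 ⟨contMDiffAt_id, ?_⟩
    refine h.congr_of_eventuallyEq (Filter.Eventually.of_forall fun y => ?_)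
    -- The trivialisation of the tangent bundle of the model space is the identity, so the section
    -- in coordinates is G itself.
    have hsymm (v : EuclideanSpace ℝ (Fin (n + 1))) :
        (trivializationAt (EuclideanSpace ℝ (Fin (n + 1)))
          (TangentSpace (𝓡 (n + 1)) : EuclideanSpace ℝ (Fin (n + 1)) → Type) x).symm y v = v :=
      (Trivialization.symmL_apply (R := ℝ) _ (mem_univ _) v).symm.trans
        (DFunLike.congr_fun (TangentBundle.symmL_model_space (𝕜 := ℝ) x y) v)
    refine ContinuousLinearMap.ext fun v => ContinuousLinearMap.ext fun w => ?_
    refine (inCoordinates_apply_eq₂ (E₃ := fun _ : EuclideanSpace ℝ (Fin (n + 1)) => ℝ)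
      (mem_univ y) (mem_univ y) (mem_univ y)).trans ?_
    rw [hsymm, hsymm]
    simp
    rfl

/-- The spacetime structure on `ℝⁿ⁺¹` given by a smooth family of Lorentzian forms and a timelike
vector field. -/
abbrev spacetimeOfForm
    (G : EuclideanSpace ℝ (Fin (n + 1)) →
      EuclideanSpace ℝ (Fin (n + 1)) →L[ℝ] EuclideanSpace ℝ (Fin (n + 1)) →L[ℝ] ℝ)
    (hG : ContDiff ℝ ∞ G) (hsymm : ∀ x v w, G x v w = G x w v)
    (hb : ∀ x, ∃ b : Module.Basis (Fin (n + 1)) ℝ (EuclideanSpace ℝ (Fin (n + 1))),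
      ∀ i j, G x (b i) (b j) = if i = j then (if i = 0 then -1 else 1) else 0)
    (T : EuclideanSpace ℝ (Fin (n + 1)) → EuclideanSpace ℝ (Fin (n + 1))) (hT : ContDiff ℝ ∞ T)
    (hTG : ∀ x, G x (T x) (T x) < 0) : Spacetime.{0} n where
  Pt := EuclideanSpace ℝ (Fin (n + 1))
  chartedSpace := chartedSpaceSelf _
  isManifold := instIsManifoldModelSpace (I := 𝓡 (n + 1))
  metric := lorentzMetricOfForm G hG hsymm hb
  orientable := by
    refine ⟨{OpenPartialHomeomorph.refl _}, ?_, fun x => ⟨_, rfl, mem_univ x⟩, ?_⟩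
    · rintro e rfl
      exact IsManifold.subset_maximalAtlas rfl
    · rintro e rfl e' rfl x -
      have : (fun y : EuclideanSpace ℝ (Fin (n + 1)) => y) = id := rfl
      simp [this, ContinuousLinearMap.det]
  timeOrientable := ⟨⟨T, contMDiff_vectorSpace_iff_contDiff.2 hT⟩, hTG⟩

namespace Spacetime

variable {G : EuclideanSpace ℝ (Fin (n + 1)) →
      EuclideanSpace ℝ (Fin (n + 1)) →L[ℝ] EuclideanSpace ℝ (Fin (n + 1)) →L[ℝ] ℝ}
    {hG : ContDiff ℝ ∞ G} {hsymm : ∀ x v w, G x v w = G x w v}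
    {hb : ∀ x, ∃ b : Module.Basis (Fin (n + 1)) ℝ (EuclideanSpace ℝ (Fin (n + 1))),
      ∀ i j, G x (b i) (b j) = if i = j then (if i = 0 then -1 else 1) else 0}
    {T : EuclideanSpace ℝ (Fin (n + 1)) → EuclideanSpace ℝ (Fin (n + 1))} {hT : ContDiff ℝ ∞ T}
    {hTG : ∀ x, G x (T x) (T x) < 0}

theorem spacetimeOfForm_dirDeriv (f : EuclideanSpace ℝ (Fin (n + 1)) → ℝ)
    (x v : EuclideanSpace ℝ (Fin (n + 1))) :
    (spacetimeOfForm G hG hsymm hb T hT hTG).dirDeriv f x v = fderiv ℝ f x v := by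
  unfold dirDeriv
  rw [mfderiv_eq_fderiv]
  rfl

/-- A vector field of `ℝⁿ⁺¹` as a smooth function. -/
def toFun (ξ : (spacetimeOfForm G hG hsymm hb T hT hTG).SmoothVectorField) :
    EuclideanSpace ℝ (Fin (n + 1)) → EuclideanSpace ℝ (Fin (n + 1)) := fun x => ξ x

theorem contDiff_toFun (ξ : (spacetimeOfForm G hG hsymm hb T hT hTG).SmoothVectorField) :
    ContDiff ℝ ∞ (toFun ξ) :=
  contMDiff_vectorSpace_iff_contDiff.1 ξ.contMDiff

variable (G hG hsymm hb T hT hTG) in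
/-- The vector field given by a smooth function. -/
def ofFun (X : EuclideanSpace ℝ (Fin (n + 1)) → EuclideanSpace ℝ (Fin (n + 1)))
    (hX : ContDiff ℝ ∞ X) : (spacetimeOfForm G hG hsymm hb T hT hTG).SmoothVectorField :=
  ⟨X, contMDiff_vectorSpace_iff_contDiff.2 hX⟩

theorem fderiv_form_apply (hG : ContDiff ℝ ∞ G)
    {Y Z : EuclideanSpace ℝ (Fin (n + 1)) → EuclideanSpace ℝ (Fin (n + 1))}
    {x : EuclideanSpace ℝ (Fin (n + 1))}
    (hY : DifferentiableAt ℝ Y x) (hZ : DifferentiableAt ℝ Z x)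
    (v : EuclideanSpace ℝ (Fin (n + 1))) :
    fderiv ℝ (fun y => G y (Y y) (Z y)) x v =
      fderiv ℝ G x v (Y x) (Z x) + G x (fderiv ℝ Y x v) (Z x) + G x (Y x) (fderiv ℝ Z x v) := by
  have h := ((((hG.differentiable (by simp)) x).hasFDerivAt.clm_apply hY.hasFDerivAt).clm_apply
    hZ.hasFDerivAt).fderiv
  rw [h]
  simp
  ring

/-- By the product rule the derivatives of Y and Z cancel against the brackets, so the condition
depends only on the values of Y and Z at the point. -/
theorem spacetimeOfForm_isKilling_iff
    (ξ : (spacetimeOfForm G hG hsymm hb T hT hTG).SmoothVectorField) :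
    (spacetimeOfForm G hG hsymm hb T hT hTG).IsKilling ξ ↔ ∀ x, KillingEqAt G (toFun ξ) x := by
  have key : ∀ (x : EuclideanSpace ℝ (Fin (n + 1)))
      (Y Z : EuclideanSpace ℝ (Fin (n + 1)) → EuclideanSpace ℝ (Fin (n + 1))),
      DifferentiableAt ℝ Y x → DifferentiableAt ℝ Z x →
      ((spacetimeOfForm G hG hsymm hb T hT hTG).dirDeriv (fun y => G y (Y y) (Z y)) x (ξ x) =
        G x (VectorField.mlieBracket (𝓡 (n + 1)) (toFun ξ) Y x) (Z x) +
        G x (Y x) (VectorField.mlieBracket (𝓡 (n + 1)) (toFun ξ) Z x) ↔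
      fderiv ℝ G x (toFun ξ x) (Y x) (Z x) + G x (fderiv ℝ (toFun ξ) x (Y x)) (Z x) +
        G x (Y x) (fderiv ℝ (toFun ξ) x (Z x)) = 0) := by
    intro x Y Z hY hZ
    have e1 := spacetimeOfForm_dirDeriv (hG := hG) (hsymm := hsymm) (hb := hb) (hT := hT)
      (hTG := hTG) (fun y => G y (Y y) (Z y)) x (toFun ξ x)
    rw [fderiv_form_apply hG hY hZ] at e1
    have e2 := mlieBracket_eq_lieBracket (toFun ξ) Y x
    have e3 := mlieBracket_eq_lieBracket (toFun ξ) Z x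
    rw [show (spacetimeOfForm G hG hsymm hb T hT hTG).dirDeriv (fun y => G y (Y y) (Z y)) x (ξ x)
      = _ from e1]
    erw [e2, e3]
    simp only [map_sub, sub_apply]
    constructor <;> intro h <;> linear_combination h
  constructor
  · intro h x v w
    refine (key x (fun _ => v) (fun _ => w) (by fun_prop) (by fun_prop)).1 (h x _ _ ?_ ?_) <;>
    exact contMDiffAt_vectorSpace_iff_contDiffAt.2 contDiffAt_const
  · intro h x Y Z hY hZ
    have hY' := (contMDiffAt_vectorSpace_iff_contDiffAt.1 hY).differentiableAt (by simp)
    have hZ' := (contMDiffAt_vectorSpace_iff_contDiffAt.1 hZ).differentiableAt (by simp)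
    exact (key x Y Z hY' hZ').2 (h x (Y x) (Z x))

end Spacetime

end Flat

theorem linearIndependent_of_orthonormal {n : ℕ} {V : Type*} [AddCommGroup V] [Module ℝ V]
    {B : V →ₗ[ℝ] V →ₗ[ℝ] ℝ} {b : Fin (n + 1) → V}
    (hb : ∀ i j, B (b i) (b j) = if i = j then (if i = 0 then -1 else 1) else 0) :
    LinearIndependent ℝ b := by
  rw [Fintype.linearIndependent_iff]
  intro c hc i
  have h : B (∑ j, c j • b j) (b i) = 0 := by rw [hc, map_zero, LinearMap.zero_apply]
  simp only [map_sum, map_smul, LinearMap.sum_apply, LinearMap.smul_apply, hb, smul_eq_mul,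
    mul_ite, mul_zero, Finset.sum_ite_eq', Finset.mem_univ, if_true] at h
  split_ifs at h <;> linarith

/-! ### The plane wave metric -/

section Wave

variable {m : ℕ}

/-- A coordinate of `ℝᵐ⁺²`. -/
abbrev coord (i : Fin (m + 1 + 1)) : EuclideanSpace ℝ (Fin (m + 1 + 1)) →L[ℝ] ℝ :=
  EuclideanSpace.proj i

/-- The vectors of the standard basis of `ℝᵐ⁺²`. -/
abbrev stdVec (i : Fin (m + 1 + 1)) : EuclideanSpace ℝ (Fin (m + 1 + 1)) :=
  EuclideanSpace.single i (1 : ℝ)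

/-- The square of the transverse radius. -/
def radiusSq (x : EuclideanSpace ℝ (Fin (m + 1 + 1))) : ℝ := ∑ i : Fin m, x i.succ.succ ^ 2

/-- The plane wave metric `2 du dv + a |x|² du² + |dx|²` with `u = x 0` and `v = x 1`. -/
def waveForm (a : ℝ) (x : EuclideanSpace ℝ (Fin (m + 1 + 1))) :
    EuclideanSpace ℝ (Fin (m + 1 + 1)) →L[ℝ] EuclideanSpace ℝ (Fin (m + 1 + 1)) →L[ℝ] ℝ :=
  (coord 0).smulRight (coord 1) + (coord 1).smulRight (coord 0)
    + ∑ i : Fin m, (coord i.succ.succ).smulRight (coord i.succ.succ)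
    + (a * radiusSq x) • (coord 0).smulRight (coord 0)

theorem waveForm_apply (a : ℝ) (x v w : EuclideanSpace ℝ (Fin (m + 1 + 1))) :
    waveForm a x v w = v 0 * w 1 + v 1 * w 0 + ∑ i : Fin m, v i.succ.succ * w i.succ.succ
      + a * radiusSq x * (v 0 * w 0) := by
  simp [waveForm, sum_apply]

theorem hasFDerivAt_radiusSq (x : EuclideanSpace ℝ (Fin (m + 1 + 1))) :
    HasFDerivAt radiusSq (∑ i : Fin m, (2 * x i.succ.succ) • (coord i.succ.succ)) x := by
  unfold radiusSq
  refine HasFDerivAt.fun_sum fun i _ => ?_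
  have h := ((coord (m := m) i.succ.succ).hasFDerivAt (x := x)).pow 2
  simpa using h

theorem contDiff_radiusSq : ContDiff ℝ ∞ (radiusSq (m := m)) :=
  ContDiff.sum fun i _ => (coord i.succ.succ).contDiff.pow 2

theorem contDiff_waveForm (a : ℝ) : ContDiff ℝ ∞ (waveForm (m := m) a) :=
  contDiff_const.add ((contDiff_const.mul contDiff_radiusSq).smul contDiff_const)

theorem fderiv_waveForm_apply (a : ℝ) (x y v w : EuclideanSpace ℝ (Fin (m + 1 + 1))) :
    fderiv ℝ (waveForm a) x y v w =
      2 * a * (∑ i : Fin m, x i.succ.succ * y i.succ.succ) * (v 0 * w 0) := by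
  have h : HasFDerivAt (waveForm (m := m) a) _ x :=
    (((hasFDerivAt_radiusSq x).const_mul a).smul_const
      ((coord 0).smulRight (coord 0))).const_add _
  rw [h.fderiv]
  simp only [ContinuousLinearMap.smulRight_apply, smul_apply, sum_apply, smul_eq_mul,
    PiLp.proj_apply, Finset.mul_sum, Finset.sum_mul]
  refine Finset.sum_congr rfl fun i _ => ?_
  ring

/-- A timelike unit vector field. -/
def waveTime (a : ℝ) (x : EuclideanSpace ℝ (Fin (m + 1 + 1))) :
    EuclideanSpace ℝ (Fin (m + 1 + 1)) := stdVec 0 - ((a * radiusSq x + 1) / 2) • stdVec 1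

theorem contDiff_waveTime (a : ℝ) : ContDiff ℝ ∞ (waveTime (m := m) a) :=
  contDiff_const.sub ((((contDiff_const.mul contDiff_radiusSq).add contDiff_const).div_const
    _).smul contDiff_const)

theorem waveForm_waveTime (a : ℝ) (x : EuclideanSpace ℝ (Fin (m + 1 + 1))) :
    waveForm a x (waveTime a x) (waveTime a x) = -1 := by
  rw [waveForm_apply]
  simp [waveTime, Fin.succ_ne_zero, Fin.succ_succ_ne_one]
  ring

theorem waveForm_symm (a : ℝ) (x v w : EuclideanSpace ℝ (Fin (m + 1 + 1))) :
    waveForm a x v w = waveForm a x w v := by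
  rw [waveForm_apply, waveForm_apply, Finset.sum_congr rfl fun i _ => mul_comm _ _]
  ring

theorem waveForm_exists_basis (a : ℝ) (x : EuclideanSpace ℝ (Fin (m + 1 + 1))) :
    ∃ b : Module.Basis (Fin (m + 1 + 1)) ℝ (EuclideanSpace ℝ (Fin (m + 1 + 1))),
      ∀ i j, waveForm a x (b i) (b j) = if i = j then (if i = 0 then -1 else 1) else 0 := by
  -- The vector ∂_u + c ∂_v has square 2c + a|x|²; the two values of c make it -1 and 1. The product
  -- of the two vectors is the mean of their squares, so they are orthogonal.
  set b : Fin (m + 1 + 1) → EuclideanSpace ℝ (Fin (m + 1 + 1)) :=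
    Fin.cons (waveTime a x) (Fin.cons (stdVec 0 + ((1 - a * radiusSq x) / 2) • stdVec 1)
      fun i => stdVec i.succ.succ) with hb
  have key : ∀ i j, waveForm a x (b i) (b j)
      = if i = j then (if i = 0 then -1 else 1) else 0 := by
    intro i j
    refine Fin.cases ?_ (fun i => ?_) i
    · refine Fin.cases ?_ (fun j => ?_) j
      · simpa [hb] using waveForm_waveTime a x
      · refine Fin.cases ?_ (fun j => ?_) j
        · rw [waveForm_apply]
          simp [hb, waveTime, Fin.succ_succ_ne_one]
          ring
        · rw [waveForm_apply]
          simp [hb, waveTime, Fin.succ_succ_ne_one, Fin.succ_ne_zero, (Fin.succ_ne_zero _).symm,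
            (Fin.succ_succ_ne_one _).symm]
    · refine Fin.cases ?_ (fun i => ?_) i
      · refine Fin.cases ?_ (fun j => ?_) j
        · rw [waveForm_apply]
          simp [hb, waveTime, Fin.succ_succ_ne_one]
          ring
        · refine Fin.cases ?_ (fun j => ?_) j
          · rw [waveForm_apply]
            simp [hb, waveTime, Fin.succ_succ_ne_one]
          · rw [waveForm_apply]
            simp [hb, Fin.succ_succ_ne_one, Fin.succ_ne_zero, (Fin.succ_ne_zero _).symm,
              (Fin.succ_succ_ne_one _).symm]
      · refine Fin.cases ?_ (fun j => ?_) j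
        · rw [waveForm_apply]
          simp [hb, waveTime, Fin.succ_succ_ne_one, Fin.succ_ne_zero, (Fin.succ_ne_zero _).symm,
            (Fin.succ_succ_ne_one _).symm]
        · refine Fin.cases ?_ (fun j => ?_) j
          · rw [waveForm_apply]
            simp [hb, Fin.succ_succ_ne_one, Fin.succ_ne_zero, (Fin.succ_ne_zero _).symm,
              (Fin.succ_succ_ne_one _).symm]
          · rw [waveForm_apply]
            simp [hb, Fin.succ_ne_zero, (Fin.succ_ne_zero _).symm,
              (Fin.succ_succ_ne_one _).symm, eq_comm]
  have hLI := linearIndependent_of_orthonormal (B := (ContinuousLinearMap.coeLM ℝ).comp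
    (waveForm a x).toLinearMap) (b := b) key
  refine ⟨basisOfLinearIndependentOfCardEqFinrank hLI (by simp), ?_⟩
  simpa using key

/-- The plane wave spacetime. For `a = 0` it is Minkowski space. -/
abbrev waveSpacetime (m : ℕ) (a : ℝ) : Spacetime.{0} (m + 1) :=
  spacetimeOfForm (waveForm a) (contDiff_waveForm a) (waveForm_symm a) (waveForm_exists_basis a)
    (waveTime a) (contDiff_waveTime a) fun x => by rw [waveForm_waveTime]; norm_num

end Wave

/-! ### The wavefront u = 0 and the explicit Killing fields -/

section Wave

variable {m : ℕ} {a : ℝ}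

/-- The null hyperplane `u = 0`. -/
def wavefront (m : ℕ) : Set (EuclideanSpace ℝ (Fin (m + 1 + 1))) := {x | x 0 = 0}

theorem isClosed_wavefront : IsClosed (wavefront m) :=
  isClosed_eq (coord 0).continuous continuous_const

theorem isConnected_wavefront : IsConnected (wavefront m) := by
  refine ⟨⟨0, by simp [wavefront]⟩, ?_⟩
  refine Convex.isPreconnected ?_
  have : wavefront m = {x | coord (m := m) 0 x = 0} := rfl
  rw [this]
  exact convex_hyperplane (coord (m := m) 0).toLinearMap.isLinear 0

namespace Spacetime

theorem waveSpacetime_dirDeriv (f : EuclideanSpace ℝ (Fin (m + 1 + 1)) → ℝ)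
    (x v : EuclideanSpace ℝ (Fin (m + 1 + 1))) :
    (waveSpacetime m a).dirDeriv f x v = fderiv ℝ f x v :=
  spacetimeOfForm_dirDeriv f x v

theorem waveSpacetime_dirDeriv_coord (x v : EuclideanSpace ℝ (Fin (m + 1 + 1))) :
    (waveSpacetime m a).dirDeriv (fun x => x 0) x v = v 0 := by
  refine (waveSpacetime_dirDeriv (a := a) _ x v).trans ?_
  change fderiv ℝ (coord 0) x v = _
  rw [ContinuousLinearMap.fderiv]
  rfl

theorem isDefiningFunction_wavefront {K U : Set (EuclideanSpace ℝ (Fin (m + 1 + 1)))}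
    {p : EuclideanSpace ℝ (Fin (m + 1 + 1))} (hU : IsOpen U) (hp : p ∈ U)
    (h : K ∩ U = wavefront m ∩ U) :
    (waveSpacetime m a).IsDefiningFunction K p U (fun x => x 0) where
  isOpen := hU
  mem := hp
  contMDiffOn := (coord (m := m) 0).contDiff.contMDiff.contMDiffOn
  deriv_ne_zero q _ := by
    exact ⟨stdVec 0, by rw [waveSpacetime_dirDeriv_coord]; simp⟩
  inter_eq := by
    rw [h]
    ext x
    simp [wavefront, and_comm]

theorem isTangentTo_wavefront_iff {W : Set (EuclideanSpace ℝ (Fin (m + 1 + 1)))} (hW : IsOpen W)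
    {p v : EuclideanSpace ℝ (Fin (m + 1 + 1))} (hp : p ∈ W ∩ wavefront m) :
    (waveSpacetime m a).IsTangentTo (W ∩ wavefront m) p v ↔ v 0 = 0 := by
  refine ((isDefiningFunction_wavefront (a := a) hW hp.1 (by
    rw [inter_right_comm, inter_self, inter_comm])).isTangentTo_iff hp).trans ?_
  exact iff_of_eq (congrArg (· = 0) (waveSpacetime_dirDeriv_coord p v))

theorem isNullHypersurface_wavefront {W : Set (EuclideanSpace ℝ (Fin (m + 1 + 1)))}
    (hW : IsOpen W) : (waveSpacetime m a).IsNullHypersurface (W ∩ wavefront m) := by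
  refine ⟨fun p hp => ⟨W, _, isDefiningFunction_wavefront hW hp.1 (by
    rw [inter_right_comm, inter_self, inter_comm])⟩, fun p hp => ⟨stdVec 1, fun h => ?_, (isTangentTo_wavefront_iff hW hp).2 ?_,
      fun v hv => ?_⟩⟩
  · have h : stdVec (m := m) 1 = 0 := h
    simp at h
  · simp
  · have hv := (isTangentTo_wavefront_iff hW hp).1 hv
    refine (waveForm_apply a p (stdVec 1) v).trans ?_
    simp [hv, Fin.succ_succ_ne_one]

theorem hypersurfaceInterior_wavefront :
    (waveSpacetime m a).hypersurfaceInterior (wavefront m) = wavefront m :=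
  Subset.antisymm (fun _ h => h.1) fun p hp =>
    ⟨hp, univ, _, isDefiningFunction_wavefront isOpen_univ (mem_univ p) rfl⟩

/-- A Killing field which is proportional to the null direction on the wavefront has a Killing
horizon there. -/
theorem isKillingHorizon_wavefront {ξ : (waveSpacetime m a).SmoothVectorField}
    (hξ : (waveSpacetime m a).IsKilling ξ) {f : EuclideanSpace ℝ (Fin (m + 1 + 1)) → ℝ}
    (hf : Continuous f) (hfξ : ∀ x ∈ wavefront m, toFun ξ x = f x • stdVec 1)
    (hd : wavefront m ⊆ closure ({x | f x ≠ 0} ∩ wavefront m)) :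
    (waveSpacetime m a).IsKillingHorizon ξ ({x | f x ≠ 0} ∩ wavefront m) ∧
      closure ({x | f x ≠ 0} ∩ wavefront m) = wavefront m := by
  have hW : IsOpen {x | f x ≠ 0} := isOpen_ne_fun hf continuous_const
  have hcl : closure ({x | f x ≠ 0} ∩ wavefront m) = wavefront m :=
    (closure_minimal inter_subset_right isClosed_wavefront).antisymm hd
  refine ⟨⟨hξ, isNullHypersurface_wavefront hW, fun p hp => ?_, fun p hp h0 => ?_,
    fun p hp => (isTangentTo_wavefront_iff hW hp).2 ?_, Or.inr ?_⟩, hcl⟩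
  · change waveForm a p (toFun ξ p) (toFun ξ p) = 0
    rw [hfξ p hp.2, waveForm_apply]
    simp [Fin.succ_succ_ne_one]
  · have h := hfξ p hp.2
    rw [show toFun ξ p = 0 from h0] at h
    have h1 := congrArg (fun y : EuclideanSpace ℝ (Fin (m + 1 + 1)) => y 1) h
    exact hp.1 (by simpa using h1.symm)
  · change toFun ξ p 0 = 0
    rw [hfξ p hp.2]
    simp
  -- The set where f ≠ 0 may be disconnected; the connectedness condition is met through the
  -- closure, which is the whole wavefront.
  · have := hypersurfaceInterior_wavefront (m := m) (a := a)
    rw [← hcl] at this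
    rw [this, hcl]
    exact isConnected_wavefront

/-- The metric varies only in its du² coefficient, which does not see ∂_v, and pairing with ∂_v
picks out the u-component. Surface gravity is thus read off from the derivative of the u-component.
-/
theorem fderiv_norm_wavefront (ξ : (waveSpacetime m a).SmoothVectorField)
    {x : EuclideanSpace ℝ (Fin (m + 1 + 1))} {c : ℝ} (hx : toFun ξ x = c • stdVec 1)
    (v : EuclideanSpace ℝ (Fin (m + 1 + 1))) :
    (waveSpacetime m a).dirDeriv (fun q => (waveSpacetime m a).g q (ξ q) (ξ q)) x v
      = 2 * c * (fderiv ℝ (toFun ξ) x v) 0 := by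
  have hd : DifferentiableAt ℝ (toFun ξ) x := (contDiff_toFun ξ).differentiable (by simp) x
  refine (waveSpacetime_dirDeriv (a := a) _ x v).trans ?_
  refine (fderiv_form_apply (contDiff_waveForm a) hd hd v).trans ?_
  rw [fderiv_waveForm_apply, waveForm_apply, waveForm_apply, hx]
  simp [Fin.succ_succ_ne_one]
  ring

end Spacetime

/-- The null translation, the boost and the null rotations. -/
def waveField (p q : ℝ → ℝ) :
    Fin (m + 1 + 1) → EuclideanSpace ℝ (Fin (m + 1 + 1)) → EuclideanSpace ℝ (Fin (m + 1 + 1)) :=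
  Fin.cons (fun _ => stdVec 1) (Fin.cons (fun x => x 1 • stdVec 1 - x 0 • stdVec 0)
    fun i x => (q (x 0) * x i.succ.succ) • stdVec 1 - p (x 0) • stdVec i.succ.succ)

/-- The restriction of the fields of `waveField` to the wavefront. -/
def horizonFactor (j : Fin (m + 1 + 1)) (x : EuclideanSpace ℝ (Fin (m + 1 + 1))) : ℝ :=
  if j = 0 then 1 else x j

variable {p q : ℝ → ℝ}

theorem waveField_of_mem_wavefront (hp : p 0 = 0) (hq : q 0 = 1) (j : Fin (m + 1 + 1))
    {x : EuclideanSpace ℝ (Fin (m + 1 + 1))} (hx : x ∈ wavefront m) :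
    waveField p q j x = horizonFactor j x • stdVec 1 := by
  have hx : x 0 = 0 := hx
  refine Fin.cases ?_ (fun j => Fin.cases ?_ (fun i => ?_) j) j
  · simp [waveField, horizonFactor]
  · simp [waveField, horizonFactor, hx]
  · simp [waveField, horizonFactor, hx, hp, hq, Fin.succ_ne_zero]

theorem contDiff_waveField (hp : ContDiff ℝ ∞ p) (hq : ContDiff ℝ ∞ q) (j : Fin (m + 1 + 1)) :
    ContDiff ℝ ∞ (waveField (m := m) p q j) := by
  have hc (i : Fin (m + 1 + 1)) : ContDiff ℝ ∞ fun x : EuclideanSpace ℝ (Fin (m + 1 + 1)) => x i :=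
    (coord i).contDiff
  refine Fin.cases contDiff_const (fun j => Fin.cases ?_ (fun i => ?_) j) j
  · exact ((hc 1).smul contDiff_const).sub ((hc 0).smul contDiff_const)
  · exact (((hq.comp (hc 0)).mul (hc _)).smul contDiff_const).sub
      ((hp.comp (hc 0)).smul contDiff_const)

theorem waveField_zero_coord {j : Fin (m + 1 + 1)} (hj : j ≠ 1)
    (x : EuclideanSpace ℝ (Fin (m + 1 + 1))) : waveField p q j x 0 = 0 := by
  revert hj
  refine Fin.cases ?_ (fun j => Fin.cases ?_ (fun i => ?_) j) j
  · simp [waveField]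
  · simp
  · simp [waveField, (Fin.succ_ne_zero _).symm]

/-- For the null rotations the du dx_i terms cancel by p' = q, and the du² terms by q' = a p. The
boost rescales u, which the term a|x|² du² does not permit unless a = 0. -/
theorem killingEqAt_waveField (hp : ∀ t, HasDerivAt p (q t) t)
    (hq : ∀ t, HasDerivAt q (a * p t) t) {j : Fin (m + 1 + 1)} (hj : j = 1 → a = 0)
    (x : EuclideanSpace ℝ (Fin (m + 1 + 1))) : KillingEqAt (waveForm a) (waveField p q j) x := by
  intro v w
  have hc (i : Fin (m + 1 + 1)) :
      HasFDerivAt (fun x : EuclideanSpace ℝ (Fin (m + 1 + 1)) => x i) (coord i) x :=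
    (coord i).hasFDerivAt
  revert hj
  refine Fin.cases (fun _ => ?_) (fun j => Fin.cases (fun hj => ?_) (fun i _ => ?_) j) j
  · rw [fderiv_waveForm_apply]
    simp [waveField, Fin.succ_succ_ne_one]
  · obtain rfl := hj rfl
    have h : HasFDerivAt (waveField (m := m) p q 1) _ x :=
      ((hc 1).smul_const (stdVec 1)).sub ((hc 0).smul_const (stdVec 0))
    change _ + waveForm 0 x (fderiv ℝ (waveField (m := m) p q 1) x v) w
      + waveForm 0 x v (fderiv ℝ (waveField (m := m) p q 1) x w) = 0
    rw [h.fderiv, fderiv_waveForm_apply, waveForm_apply, waveForm_apply]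
    simp [Fin.succ_succ_ne_one, Fin.succ_ne_zero]
    ring
  · have h : HasFDerivAt (waveField (m := m) p q i.succ.succ) _ x :=
      (((((hq (x 0)).comp_hasFDerivAt x (hc 0)).mul (hc i.succ.succ)).smul_const (stdVec 1))).sub
        (((hp (x 0)).comp_hasFDerivAt x (hc 0)).smul_const (stdVec i.succ.succ))
    rw [h.fderiv, fderiv_waveForm_apply, waveForm_apply, waveForm_apply]
    simp [waveField, Fin.succ_succ_ne_one, (Fin.succ_ne_zero _).symm,
      (Fin.succ_succ_ne_one _).symm, eq_comm]
    ring

theorem continuous_horizonFactor (j : Fin (m + 1 + 1)) :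
    Continuous (horizonFactor (m := m) j) := by
  unfold horizonFactor
  split_ifs
  · exact continuous_const
  · exact (coord j).continuous

/-- The factor is 1 or a coordinate other than u; a zero of the latter is left by moving along that
coordinate, which stays in u = 0. -/
theorem wavefront_subset_closure (j : Fin (m + 1 + 1)) :
    wavefront m ⊆ closure ({x | horizonFactor j x ≠ 0} ∩ wavefront m) := by
  intro x hx
  by_cases hj : j = 0
  · exact subset_closure ⟨by simp [horizonFactor, hj], hx⟩
  by_cases hxj : x j = 0
  · have hlim : Filter.Tendsto (fun t : ℝ => x + t • stdVec j) (𝓝[≠] 0) (𝓝 x) := by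
      have : Continuous fun t : ℝ => x + t • stdVec j := by fun_prop
      have h := this.tendsto 0
      simp only [zero_smul, add_zero] at h
      exact h.mono_left nhdsWithin_le_nhds
    refine mem_closure_of_tendsto hlim ?_
    filter_upwards [self_mem_nhdsWithin] with t ht
    have hx : x 0 = 0 := hx
    refine ⟨?_, ?_⟩
    · simpa [horizonFactor, hj, hxj] using ht
    · simp [wavefront, hx, Ne.symm hj]
  · exact subset_closure ⟨by simpa [horizonFactor, hj] using hxj, hx⟩

/-- On the wavefront the fields are ∂_v times 1 and the coordinates other than u; evaluation at 0
and at the basis vectors separates the coefficients. -/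
theorem linearIndependent_of_horizonFactor
    {X : Fin (m + 1 + 1) → EuclideanSpace ℝ (Fin (m + 1 + 1)) → EuclideanSpace ℝ (Fin (m + 1 + 1))}
    (hX : ∀ j, ∀ x ∈ wavefront m, X j x = horizonFactor j x • stdVec 1) :
    LinearIndependent ℝ X := by
  rw [Fintype.linearIndependent_iff]
  intro c hc
  have key : ∀ x ∈ wavefront m, ∑ j, c j * horizonFactor j x = 0 := by
    intro x hx
    have h := congrArg (fun y : EuclideanSpace ℝ (Fin (m + 1 + 1)) => y 1) (congrFun hc x)
    simp only [Finset.sum_apply, Pi.smul_apply] at h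
    rw [Finset.sum_congr rfl fun j _ => by rw [hX j x hx]] at h
    simpa using h
  have h0 : c 0 = 0 := by
    have h := key 0 (by simp [wavefront])
    rw [Finset.sum_eq_single 0 (fun j _ hj => by simp [horizonFactor, hj]) (by simp)] at h
    simpa [horizonFactor] using h
  intro j
  by_cases hj : j = 0
  · rw [hj, h0]
  have h := key (stdVec j) (by simp [wavefront, Ne.symm hj])
  rw [Finset.sum_eq_single j (fun k _ hk => ?_) (by simp)] at h
  · simpa [horizonFactor, hj] using h
  · by_cases hk0 : k = 0
    · rw [hk0, h0, zero_mul]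
    · simp [horizonFactor, hk0, hk]

end Wave

/-! ### Killing fields of the plane wave with a = 1 are degenerate on u = 0 -/

section Wave

variable {m : ℕ} {X : EuclideanSpace ℝ (Fin (m + 1 + 1)) → EuclideanSpace ℝ (Fin (m + 1 + 1))}

theorem hasDerivAt_coord_comp (hX : Differentiable ℝ X)
    {γ : ℝ → EuclideanSpace ℝ (Fin (m + 1 + 1))} {γ' : EuclideanSpace ℝ (Fin (m + 1 + 1))} {t : ℝ}
    (h : HasDerivAt γ γ' t) (i : Fin (m + 1 + 1)) :
    HasDerivAt (fun s => X (γ s) i) (fderiv ℝ X (γ t) γ' i) t :=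
  (coord i).hasFDerivAt.comp_hasDerivAt t ((hX _).hasFDerivAt.comp_hasDerivAt t h)

theorem hasDerivAt_line (x w : EuclideanSpace ℝ (Fin (m + 1 + 1))) (t : ℝ) :
    HasDerivAt (fun t : ℝ => x + t • w) w t := by
  simpa using ((hasDerivAt_id t).smul_const w).const_add x

theorem fderiv_coord_zero_of_line (hX : Differentiable ℝ X)
    {x w : EuclideanSpace ℝ (Fin (m + 1 + 1))} (h : ∀ t : ℝ, X (x + t • w) 0 = X x 0) :
    fderiv ℝ X x w 0 = 0 := by
  have h1 := hasDerivAt_coord_comp hX (hasDerivAt_line x w 0) 0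
  simp only [h, zero_smul, add_zero] at h1
  exact h1.unique (hasDerivAt_const _ _)

/-- Killing fields of a plane wave restrict to Killing fields of the flat slices `u = const`. -/
theorem KillingEqAt.wave_line {a : ℝ} (hX : Differentiable ℝ X)
    (hK : ∀ x, KillingEqAt (waveForm a) X x) {w : EuclideanSpace ℝ (Fin (m + 1 + 1))}
    (hw : w 0 = 0) (x : EuclideanSpace ℝ (Fin (m + 1 + 1))) (t : ℝ) :
    w 1 * X (x + t • w) 0 + ∑ i : Fin m, w i.succ.succ * X (x + t • w) i.succ.succ =
      w 1 * X x 0 + ∑ i : Fin m, w i.succ.succ * X x i.succ.succ := by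
  -- The quantity is g(w, X). It is conserved because w 0 = 0 removes the derivative of the metric
  -- from the Killing equation on (w, w).
  have hd (t : ℝ) : HasDerivAt (fun t : ℝ => w 1 * X (x + t • w) 0
      + ∑ i : Fin m, w i.succ.succ * X (x + t • w) i.succ.succ) 0 t := by
    have h := ((hasDerivAt_coord_comp hX (hasDerivAt_line x w t) 0).const_mul (w 1)).add
      (HasDerivAt.fun_sum (u := Finset.univ) fun (i : Fin m) _ =>
        (hasDerivAt_coord_comp hX (hasDerivAt_line x w t) i.succ.succ).const_mul (w i.succ.succ))
    have hk := hK (x + t • w) w w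
    rw [waveForm_symm a _ _ w, fderiv_waveForm_apply, waveForm_apply, hw] at hk
    refine h.congr_deriv ?_
    linarith
  have h := is_const_of_deriv_eq_zero (fun t => (hd t).differentiableAt) (fun t => (hd t).deriv) t 0
  simpa using h

theorem KillingEqAt.wave_apply_zero {a : ℝ} (hX : Differentiable ℝ X)
    (hK : ∀ x, KillingEqAt (waveForm a) X x) (x : EuclideanSpace ℝ (Fin (m + 1 + 1))) (t : ℝ) :
    X (x + t • stdVec 1) 0 = X x 0 := by
  simpa [Fin.succ_succ_ne_one] using KillingEqAt.wave_line hX hK (w := stdVec 1) (by simp) x t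

/-- The transverse radial component of a vector field. -/
def radialPart (X : EuclideanSpace ℝ (Fin (m + 1 + 1)) → EuclideanSpace ℝ (Fin (m + 1 + 1)))
    (x : EuclideanSpace ℝ (Fin (m + 1 + 1))) : ℝ :=
  ∑ i : Fin m, x i.succ.succ * X x i.succ.succ

/-- The sum of y_i X_i is conserved along the transverse line in direction y, and the radial part at
parameter t is t times it. -/
theorem KillingEqAt.radialPart_smul {a : ℝ} (hX : Differentiable ℝ X)
    (hK : ∀ x, KillingEqAt (waveForm a) X x) (u : ℝ) {y : EuclideanSpace ℝ (Fin (m + 1 + 1))}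
    (h0 : y 0 = 0) (h1 : y 1 = 0) (t : ℝ) :
    radialPart X (u • stdVec 0 + t • y) = t * radialPart X (u • stdVec 0 + y) := by
  have h := (KillingEqAt.wave_line hX hK h0 (u • stdVec 0) t).trans
    (KillingEqAt.wave_line hX hK h0 (u • stdVec 0) 1).symm
  simp only [h1, zero_mul, zero_add, one_smul] at h
  unfold radialPart
  simp only [PiLp.add_apply, PiLp.smul_apply, PiLp.single_apply, Fin.succ_ne_zero, if_false,
    mul_zero, zero_add, smul_eq_mul, mul_assoc, ← Finset.mul_sum, h]

/-- The derivative of the `u`-component in the direction of `u`. -/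
def horizonRate (X : EuclideanSpace ℝ (Fin (m + 1 + 1)) → EuclideanSpace ℝ (Fin (m + 1 + 1)))
    (x : EuclideanSpace ℝ (Fin (m + 1 + 1))) : ℝ := fderiv ℝ X x (stdVec 0) 0

theorem continuous_horizonRate (hX : ContDiff ℝ ∞ X) : Continuous (horizonRate X) :=
  (coord 0).continuous.comp ((hX.continuous_fderiv (by simp)).clm_apply continuous_const)

theorem KillingEqAt.horizonRate_add {a : ℝ} (hX : Differentiable ℝ X)
    (hK : ∀ x, KillingEqAt (waveForm a) X x) (x : EuclideanSpace ℝ (Fin (m + 1 + 1))) (t : ℝ) :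
    horizonRate X (x + t • stdVec 1) = horizonRate X x := by
  have h1 := hasDerivAt_coord_comp hX (hasDerivAt_line (x + t • stdVec 1) (stdVec 0) 0) 0
  have h2 := hasDerivAt_coord_comp hX (hasDerivAt_line x (stdVec 0) 0) 0
  simp only [add_right_comm x (t • stdVec 1), KillingEqAt.wave_apply_zero hX hK] at h1
  simpa [horizonRate] using h1.unique h2

/-- The (∂_u, ∂_v) entry of the Killing equation says ∂_v X^v = -∂_u X^u, and the right side is
independent of v. -/
theorem KillingEqAt.wave_apply_one {a : ℝ} (hX : Differentiable ℝ X)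
    (hK : ∀ x, KillingEqAt (waveForm a) X x) (x : EuclideanSpace ℝ (Fin (m + 1 + 1))) (t : ℝ) :
    X (x + t • stdVec 1) 1 = X x 1 - t * horizonRate X x := by
  have hd (t : ℝ) : HasDerivAt (fun t : ℝ => X (x + t • stdVec 1) 1 + t * horizonRate X x) 0 t := by
    have h := (hasDerivAt_coord_comp hX (hasDerivAt_line x (stdVec 1) t) 1).add
      ((hasDerivAt_id t).mul_const (horizonRate X x))
    have hk := hK (x + t • stdVec 1) (stdVec 0) (stdVec 1)
    have hz : fderiv ℝ X (x + t • stdVec 1) (stdVec 1) 0 = 0 :=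
      fderiv_coord_zero_of_line hX fun s => KillingEqAt.wave_apply_zero hX hK _ s
    have hr := KillingEqAt.horizonRate_add hX hK x t
    rw [fderiv_waveForm_apply, waveForm_apply, waveForm_apply, hz] at hk
    simp [Fin.succ_succ_ne_one, Fin.succ_ne_zero] at hk
    refine h.congr_deriv ?_
    rw [← hr, horizonRate]
    linarith
  have h := is_const_of_deriv_eq_zero (fun t => (hd t).differentiableAt) (fun t => (hd t).deriv) t 0
  simp only [zero_smul, add_zero, zero_mul] at h
  linarith

theorem radiusSq_smul_add (u v c : ℝ) (y : EuclideanSpace ℝ (Fin (m + 1 + 1))) :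
    radiusSq (u • stdVec 0 + v • stdVec 1 + c • y) = c ^ 2 * radiusSq y := by
  simp [radiusSq, Fin.succ_succ_ne_one, Fin.succ_ne_zero, mul_pow, Finset.mul_sum]

/-- Conservation along the null geodesics `(s, v - ε|y|²e^{2εs}/2, y e^{εs})` of the plane wave. -/
theorem KillingEqAt.wave_geodesic (hX : Differentiable ℝ X)
    (hK : ∀ x, KillingEqAt (waveForm 1) X x) {y : EuclideanSpace ℝ (Fin (m + 1 + 1))}
    (h0 : y 0 = 0) (h1 : y 1 = 0) {ε : ℝ} (hε : ε ^ 2 = 1) (v : ℝ)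
    {γ : ℝ → EuclideanSpace ℝ (Fin (m + 1 + 1))}
    (hγ : ∀ s, γ s = s • stdVec 0 + (v - ε * radiusSq y * Real.exp (ε * s) ^ 2 / 2) • stdVec 1
      + Real.exp (ε * s) • y) (s : ℝ) :
    X (γ s) 1 + ε * radialPart X (γ s) = X (γ 0) 1 + ε * radialPart X (γ 0) := by
  have hγy (s : ℝ) (i : Fin m) : γ s i.succ.succ = Real.exp (ε * s) * y i.succ.succ := by
    simp [hγ, Fin.succ_succ_ne_one, Fin.succ_ne_zero]
  have hexp (s : ℝ) : HasDerivAt (fun s => Real.exp (ε * s)) (ε * Real.exp (ε * s)) s := by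
    simpa [mul_comm] using ((hasDerivAt_id s).const_mul ε).exp
  -- This is g(γ', X): the u-component of X drops out because the v-component of γ' is minus the
  -- squared transverse radius.
  have hd (s : ℝ) : HasDerivAt (fun s => X (γ s) 1 + ε * radialPart X (γ s)) 0 s := by
    set γ' := stdVec 0 + (-(radiusSq y * Real.exp (ε * s) ^ 2)) • stdVec 1
      + (ε * Real.exp (ε * s)) • y with hγ'
    have hc : HasDerivAt γ γ' s := by
      rw [funext hγ]
      have h := (((hasDerivAt_id s).smul_const (stdVec (m := m) 0)).add
        ((((((hexp s).pow 2).const_mul (ε * radiusSq y)).div_const 2).const_sub v).smul_const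
          (stdVec 1))).add ((hexp s).smul_const y)
      refine h.congr_deriv ?_
      rw [hγ', one_smul]
      congr 3
      push_cast
      linear_combination (-radiusSq y * Real.exp (ε * s) ^ 2) * hε
    have h := (hasDerivAt_coord_comp hX hc 1).add ((HasDerivAt.fun_sum (u := Finset.univ)
      fun (i : Fin m) _ => ((hexp s).mul_const (y i.succ.succ)).mul
        (hasDerivAt_coord_comp hX hc i.succ.succ)).const_mul ε)
    have hk := hK (γ s) γ' γ'
    have hr : radiusSq (γ s) = Real.exp (ε * s) ^ 2 * radiusSq y := by
      rw [hγ, radiusSq_smul_add]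
    have e0 : γ' 0 = 1 := by simp [hγ', h0]
    have e1 : γ' 1 = -(radiusSq y * Real.exp (ε * s) ^ 2) := by simp [hγ', h1]
    have ei (i : Fin m) : γ' i.succ.succ = ε * Real.exp (ε * s) * y i.succ.succ := by
      simp [hγ', Fin.succ_succ_ne_one, Fin.succ_ne_zero]
    rw [waveForm_symm 1 _ γ', fderiv_waveForm_apply, waveForm_apply, hr] at hk
    simp only [e0, e1, ei, hγy] at hk
    have hfun : (fun s => X (γ s) 1 + ε * radialPart X (γ s)) = fun s => X (γ s) 1 + ε *
        ∑ i : Fin m, (Real.exp (ε * s) * y i.succ.succ) * X (γ s) i.succ.succ := by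
      simp only [radialPart, hγy]
    rw [hfun]
    refine h.congr_deriv ?_
    have es : ε * ∑ i : Fin m, (ε * Real.exp (ε * s) * y i.succ.succ * X (γ s) i.succ.succ +
        Real.exp (ε * s) * y i.succ.succ * fderiv ℝ X (γ s) γ' i.succ.succ) =
        ∑ i : Fin m, Real.exp (ε * s) * y i.succ.succ * X (γ s) i.succ.succ +
        ∑ i : Fin m, fderiv ℝ X (γ s) γ' i.succ.succ * (ε * Real.exp (ε * s) * y i.succ.succ) := by
      rw [Finset.mul_sum, ← Finset.sum_add_distrib]
      refine Finset.sum_congr rfl fun i _ => ?_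
      linear_combination (Real.exp (ε * s) * y i.succ.succ * X (γ s) i.succ.succ) * hε
    rw [es]
    linarith
  exact is_const_of_deriv_eq_zero (fun t => (hd t).differentiableAt) (fun t => (hd t).deriv) s 0

theorem radialPart_of_mem_wavefront (hH : ∀ x ∈ wavefront m, X x = X x 1 • stdVec 1)
    {x : EuclideanSpace ℝ (Fin (m + 1 + 1))} (hx : x ∈ wavefront m) : radialPart X x = 0 := by
  rw [radialPart, hH x hx]
  simp [Fin.succ_succ_ne_one]

/-- The null geodesic through (u, 0, y) is followed back to u = 0, where the radial part vanishes.
Its v-coordinate there is removed by `KillingEqAt.wave_apply_one`, which produces the term with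
`horizonRate`. -/
theorem KillingEqAt.wave_transport (hX : Differentiable ℝ X)
    (hK : ∀ x, KillingEqAt (waveForm 1) X x) (hH : ∀ x ∈ wavefront m, X x = X x 1 • stdVec 1)
    {y : EuclideanSpace ℝ (Fin (m + 1 + 1))} (h0 : y 0 = 0) (h1 : y 1 = 0) {ε : ℝ}
    (hε : ε ^ 2 = 1) (u : ℝ) :
    X (u • stdVec 0 + y) 1 + ε * radialPart X (u • stdVec 0 + y) =
      X (Real.exp (-(ε * u)) • y) 1 - ε * radiusSq y * (1 - Real.exp (-(ε * u)) ^ 2) / 2 *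
        horizonRate X (Real.exp (-(ε * u)) • y) := by
  set c := Real.exp (-(ε * u)) with hc
  have hcu : Real.exp (ε * u) * c = 1 := by rw [hc, ← Real.exp_add]; simp
  have hry : radiusSq (c • y) = c ^ 2 * radiusSq y := by
    simpa using radiusSq_smul_add 0 0 c y
  -- The offset ε * radiusSq y / 2 makes the v-coordinate zero at parameter u.
  have h := KillingEqAt.wave_geodesic hX hK (y := c • y) (by simp [h0]) (by simp [h1]) hε
    (ε * radiusSq y / 2) (fun s => rfl) u
  have e1 : u • stdVec 0 + (ε * radiusSq y / 2
      - ε * radiusSq (c • y) * Real.exp (ε * u) ^ 2 / 2) • stdVec 1 + Real.exp (ε * u) • c • y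
      = u • stdVec 0 + y := by
    rw [smul_smul, hcu, one_smul, hry, show ε * radiusSq y / 2
      - ε * (c ^ 2 * radiusSq y) * Real.exp (ε * u) ^ 2 / 2 = ε * radiusSq y / 2 *
        (1 - (Real.exp (ε * u) * c) ^ 2) by ring, hcu]
    simp
  have e2 : (0 : ℝ) • stdVec 0 + (ε * radiusSq y / 2
      - ε * radiusSq (c • y) * Real.exp (ε * 0) ^ 2 / 2) • stdVec 1 + Real.exp (ε * 0) • c • y
      = c • y + (ε * radiusSq y * (1 - c ^ 2) / 2) • stdVec 1 := by
    rw [hry, mul_zero, Real.exp_zero, zero_smul, zero_add, one_smul,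
      add_comm _ (c • y)]
    congr 2
    ring
  have e3 : radialPart X (c • y + (ε * radiusSq y * (1 - c ^ 2) / 2) • stdVec 1) = 0 :=
    radialPart_of_mem_wavefront hH (by simp [wavefront, h0])
  rw [e1, e2, e3, KillingEqAt.wave_apply_one hX hK] at h
  linarith

/-- A Killing field of the plane wave which is null and tangent on `u = 0` has no `u`-derivative
of its `u`-component there. -/
theorem KillingEqAt.horizonRate_eq_zero (hX : ContDiff ℝ ∞ X)
    (hK : ∀ x, KillingEqAt (waveForm 1) X x) (hH : ∀ x ∈ wavefront m, X x = X x 1 • stdVec 1)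
    {y : EuclideanSpace ℝ (Fin (m + 1 + 1))} (h0 : y 0 = 0) (h1 : y 1 = 0) (hy : radiusSq y ≠ 0) :
    horizonRate X y = 0 := by
  have hXd := hX.differentiable (by simp)
  have hα := continuous_horizonRate hX
  set A : ℝ → EuclideanSpace ℝ (Fin (m + 1 + 1)) → ℝ := fun u y =>
    (Real.exp u ^ 2 - 1) * horizonRate X (Real.exp u • y)
      - (1 - Real.exp (-u) ^ 2) * horizonRate X (Real.exp (-u) • y) with hA
  -- Subtracting the transports for ε = 1 and ε = -1 isolates the radial part; adding the results
  -- for u and -u cancels the values of X 1 on the wavefront.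
  have hsum (u : ℝ) {y : EuclideanSpace ℝ (Fin (m + 1 + 1))} (h0 : y 0 = 0) (h1 : y 1 = 0) :
      2 * (radialPart X (u • stdVec 0 + y) + radialPart X ((-u) • stdVec 0 + y))
        = radiusSq y * A u y := by
    have k1 := KillingEqAt.wave_transport hXd hK hH h0 h1 (ε := 1) (by norm_num) u
    have k2 := KillingEqAt.wave_transport hXd hK hH h0 h1 (ε := -1) (by norm_num) u
    have k3 := KillingEqAt.wave_transport hXd hK hH h0 h1 (ε := 1) (by norm_num) (-u)
    have k4 := KillingEqAt.wave_transport hXd hK hH h0 h1 (ε := -1) (by norm_num) (-u)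
    simp only [one_mul, neg_mul, neg_neg] at k1 k2 k3 k4
    simp only [hA]
    linarith
  -- In `hsum` the left side has degree one in y and `radiusSq` degree two, so A u y = t * A u (t •
  -- y) for t ≠ 0; let t tend to 0.
  have hA0 (u : ℝ) {y : EuclideanSpace ℝ (Fin (m + 1 + 1))} (h0 : y 0 = 0) (h1 : y 1 = 0)
      (hy : radiusSq y ≠ 0) : A u y = 0 := by
    have hcont : Continuous (A u) :=
      (continuous_const.mul (hα.comp (continuous_const_smul _))).sub
        (continuous_const.mul (hα.comp (continuous_const_smul _)))
    have hlim : Filter.Tendsto (fun t : ℝ => t * A u (t • y)) (𝓝[≠] 0) (𝓝 0) := by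
      have : Continuous fun t : ℝ => t * A u (t • y) :=
        continuous_id.mul (hcont.comp (continuous_id.smul continuous_const))
      have h := this.tendsto 0
      rw [zero_mul] at h
      exact h.mono_left nhdsWithin_le_nhds
    refine tendsto_nhds_unique (tendsto_const_nhds.congr' ?_) hlim
    filter_upwards [self_mem_nhdsWithin] with t ht
    have k1 := hsum u h0 h1
    have k2 := hsum u (y := t • y) (by simp [h0]) (by simp [h1])
    rw [KillingEqAt.radialPart_smul hXd hK u h0 h1, KillingEqAt.radialPart_smul hXd hK (-u) h0 h1,
      show radiusSq (t • y) = t ^ 2 * radiusSq y by simpa using radiusSq_smul_add 0 0 t y] at k2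
    have ht : t ≠ 0 := ht
    refine mul_left_cancel₀ (mul_ne_zero ht hy) ?_
    linear_combination t * (-k1) + k2
  -- A u = 0 at exp u • y compares the rates at y and at exp u ^ 2 • y. As u tends to -∞ the right
  -- side tends to 0.
  have hscale (u : ℝ) (hu : u ≠ 0) :
      horizonRate X y = Real.exp u ^ 2 * horizonRate X (Real.exp u ^ 2 • y) := by
    have hr : radiusSq (Real.exp u • y) = Real.exp u ^ 2 * radiusSq y := by
      simpa using radiusSq_smul_add 0 0 (Real.exp u) y
    have h := hA0 u (y := Real.exp u • y) (by simp [h0]) (by simp [h1])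
      (by rw [hr]; exact mul_ne_zero (by positivity) hy)
    have hcu : Real.exp (-u) * Real.exp u = 1 := by rw [← Real.exp_add]; simp
    simp only [hA, smul_smul, hcu, one_smul, ← sq] at h
    have hne : Real.exp u ^ 2 - 1 ≠ 0 := by
      intro h2
      have h3 : Real.exp u = 1 := by
        have := Real.exp_pos u
        nlinarith
      exact hu (Real.exp_eq_one_iff u |>.1 h3)
    refine mul_left_cancel₀ hne ?_
    linear_combination -(Real.exp u ^ 2 * h) + horizonRate X y *
      (Real.exp (-u) * Real.exp u + 1) * hcu
  have hlim : Filter.Tendsto (fun u : ℝ => Real.exp u ^ 2 * horizonRate X (Real.exp u ^ 2 • y))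
      Filter.atBot (𝓝 0) := by
    have : Continuous fun t : ℝ => t ^ 2 * horizonRate X (t ^ 2 • y) :=
      (continuous_pow 2).mul (hα.comp ((continuous_pow 2).smul continuous_const))
    have h := (this.tendsto 0).comp Real.tendsto_exp_atBot
    simpa [Function.comp_def] using h
  refine tendsto_nhds_unique (tendsto_const_nhds.congr' ?_) hlim
  filter_upwards [Filter.eventually_ne_atBot 0] with u hu
  exact hscale u hu

/-- Tangential derivatives vanish with the u-component itself, which leaves the rate. Invariance in
v reduces to v = 0, and points of zero transverse radius follow by continuity along a transverse
direction, available since m ≥ 1. -/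
theorem KillingEqAt.fderiv_wave_zero (hm : 1 ≤ m) (hX : ContDiff ℝ ∞ X)
    (hK : ∀ x, KillingEqAt (waveForm 1) X x) (hH : ∀ x ∈ wavefront m, X x = X x 1 • stdVec 1)
    {x : EuclideanSpace ℝ (Fin (m + 1 + 1))} (hx : x ∈ wavefront m)
    (v : EuclideanSpace ℝ (Fin (m + 1 + 1))) : fderiv ℝ X x v 0 = 0 := by
  have hXd := hX.differentiable (by simp)
  have hx : x 0 = 0 := hx
  have hα : horizonRate X x = 0 := by
    set y := x - x 1 • stdVec 1 with hy
    have e : x = y + x 1 • stdVec 1 := by rw [hy, sub_add_cancel]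
    rw [e, KillingEqAt.horizonRate_add hXd hK]
    have h0 : y 0 = 0 := by simp [hy, hx]
    have h1 : y 1 = 0 := by simp [hy]
    by_cases hr : radiusSq y = 0
    · obtain ⟨k⟩ : Nonempty (Fin m) := ⟨⟨0, hm⟩⟩
      set z : EuclideanSpace ℝ (Fin (m + 1 + 1)) := stdVec k.succ.succ with hz
      have hy0 (i : Fin m) : y i.succ.succ = 0 := by
        have := (Finset.sum_eq_zero_iff_of_nonneg fun i _ => sq_nonneg _).1 hr i (Finset.mem_univ i)
        simpa using this
      have hlim : Filter.Tendsto (fun t : ℝ => horizonRate X (y + t • z)) (𝓝[≠] 0)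
          (𝓝 (horizonRate X y)) := by
        have : Continuous fun t : ℝ => horizonRate X (y + t • z) :=
          (continuous_horizonRate hX).comp (by fun_prop)
        have h := this.tendsto 0
        rw [zero_smul, add_zero] at h
        exact h.mono_left nhdsWithin_le_nhds
      refine tendsto_nhds_unique hlim (tendsto_const_nhds.congr' ?_)
      filter_upwards [self_mem_nhdsWithin] with t ht
      refine (KillingEqAt.horizonRate_eq_zero hX hK hH ?_ ?_ ?_).symm
      · simp [h0, hz, (Fin.succ_ne_zero _).symm]
      · simp [h1, hz, (Fin.succ_succ_ne_one _).symm]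
      · have : radiusSq (y + t • z) = t ^ 2 := by
          rw [radiusSq, Finset.sum_eq_single k]
          · simp [hy0, hz]
          · intro i _ hi
            simp [hy0, hz, hi]
          · simp
        rw [this]
        exact pow_ne_zero 2 ht
    · exact KillingEqAt.horizonRate_eq_zero hX hK hH h0 h1 hr
  have hv : v = v 0 • stdVec 0 + (v - v 0 • stdVec 0) := by rw [add_sub_cancel]
  have hw : fderiv ℝ X x (v - v 0 • stdVec 0) 0 = 0 := by
    refine fderiv_coord_zero_of_line hXd fun t => ?_
    rw [hH x hx, hH _ (by simp [wavefront, hx])]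
    simp
  rw [hv, map_add, map_smul, PiLp.add_apply, PiLp.smul_apply, hw,
    show fderiv ℝ X x (stdVec 0) 0 = 0 from hα]
  simp

end Wave

/-! ### The bounds are attained -/

theorem le_rank_span_of_linearIndependent {N : ℕ} {V : Type u} [AddCommGroup V] [Module ℝ V]
    {s : Set V} {v : Fin N → V} (hv : LinearIndependent ℝ v) (hs : ∀ i, v i ∈ s) :
    (N : Cardinal.{u}) ≤ Module.rank ℝ (Submodule.span ℝ s) := by
  have h : LinearIndependent ℝ fun i => (⟨v i, Submodule.subset_span (hs i)⟩ : Submodule.span ℝ s) :=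
    LinearIndependent.of_comp (Submodule.span ℝ s).subtype hv
  simpa using h.cardinal_lift_le_rank

namespace Spacetime

variable {m : ℕ} {a : ℝ}

/-- The linear map that sends a vector field of a plane wave spacetime to its components. -/
def toFunLinear : (waveSpacetime m a).SmoothVectorField →ₗ[ℝ]
    (EuclideanSpace ℝ (Fin (m + 1 + 1)) → EuclideanSpace ℝ (Fin (m + 1 + 1))) where
  toFun := toFun
  map_add' _ _ := rfl
  map_smul' _ _ := rfl

variable {ξ : (waveSpacetime m a).SmoothVectorField}
  {K : Set (EuclideanSpace ℝ (Fin (m + 1 + 1)))}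

/-- On K tangency kills the u-component, and then nullity kills the transverse ones. The condition
is closed, so it extends to the closure. -/
theorem IsKillingHorizon.eq_on_wavefront (hK : (waveSpacetime m a).IsKillingHorizon ξ K)
    (hcl : closure K = wavefront m) :
    ∀ x ∈ wavefront m, toFun ξ x = toFun ξ x 1 • stdVec 1 := by
  obtain ⟨W, hW, hKW⟩ := hK.isNullHypersurface.1.exists_isOpen
  rw [hcl] at hKW
  have hX := (contDiff_toFun ξ).continuous
  have hc : IsClosed {x | toFun ξ x = toFun ξ x 1 • stdVec 1} :=
    isClosed_eq hX (((coord 1).continuous.comp hX).smul continuous_const)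
  rw [← hcl]
  refine closure_minimal (fun x hx => ?_) hc
  have h0 : toFun ξ x 0 = 0 := by
    have ht := hK.tangent x hx
    rw [hKW] at ht hx
    exact (isTangentTo_wavefront_iff hW hx).1 ht
  have hn : waveForm a x (toFun ξ x) (toFun ξ x) = 0 := hK.null x hx
  rw [waveForm_apply, h0] at hn
  simp only [zero_mul, mul_zero, zero_add, add_zero] at hn
  simp only [← sq] at hn
  rw [Finset.sum_eq_zero_iff_of_nonneg fun i _ => sq_nonneg _] at hn
  ext i
  refine Fin.cases ?_ (fun i => Fin.cases ?_ (fun i => ?_) i) i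
  · simpa using h0
  · simp
  · simpa [Fin.succ_succ_ne_one] using hn i (Finset.mem_univ i)

theorem isSurfaceGravity_zero_of_fderiv (hKH : K ⊆ wavefront m)
    (hH : ∀ x ∈ wavefront m, toFun ξ x = toFun ξ x 1 • stdVec 1)
    (h : ∀ x ∈ wavefront m, ∀ v, fderiv ℝ (toFun ξ) x v 0 = 0) :
    (waveSpacetime m a).IsSurfaceGravity ξ K 0 := by
  intro x hx v
  refine (fderiv_norm_wavefront ξ (hH x (hKH hx)) v).trans ?_
  rw [h x (hKH hx) v]
  simp

theorem isFullyDegenerate_wavefront (hm : 1 ≤ m) :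
    (waveSpacetime m 1).IsFullyDegenerate (wavefront m) := by
  refine Subset.antisymm ?_ ?_
  · rintro ξ (h | ⟨K, hK, hcl⟩)
    · exact Or.inl h
    refine Or.inr ⟨K, hK, hcl, ?_⟩
    have hcl' : closure K = wavefront m := hcl.trans isClosed_wavefront.closure_eq
    have hH := hK.eq_on_wavefront hcl'
    exact isSurfaceGravity_zero_of_fderiv (hcl' ▸ subset_closure) hH fun x hx v =>
      KillingEqAt.fderiv_wave_zero hm (contDiff_toFun ξ)
        ((spacetimeOfForm_isKilling_iff ξ).1 hK.isKilling) hH hx v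
  · rintro ξ (h | ⟨K, hK, hcl, -⟩)
    · exact Or.inl h
    · exact Or.inr ⟨K, hK, hcl⟩

variable {p q : ℝ → ℝ} {hp : ContDiff ℝ ∞ p} {hq : ContDiff ℝ ∞ q}

variable (a) in
/-- The null translation, the boost and the null rotations of a plane wave spacetime. -/
def waveKilling (hp : ContDiff ℝ ∞ p) (hq : ContDiff ℝ ∞ q) (j : Fin (m + 1 + 1)) :
    (waveSpacetime m a).SmoothVectorField :=
  ofFun _ _ _ _ _ _ _ (waveField p q j) (contDiff_waveField hp hq j)

theorem toFun_waveKilling (j : Fin (m + 1 + 1)) :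
    toFun (waveKilling a hp hq j) = waveField p q j := rfl

theorem linearIndependent_waveKilling (hp0 : p 0 = 0) (hq0 : q 0 = 1) :
    LinearIndependent ℝ (waveKilling (m := m) a hp hq) :=
  LinearIndependent.of_comp toFunLinear <| linearIndependent_of_horizonFactor fun j _ hx =>
    waveField_of_mem_wavefront hp0 hq0 j hx

theorem isKillingHorizon_waveKilling (hp0 : p 0 = 0) (hq0 : q 0 = 1)
    (hp' : ∀ t, HasDerivAt p (q t) t) (hq' : ∀ t, HasDerivAt q (a * p t) t)
    {j : Fin (m + 1 + 1)} (hj : j = 1 → a = 0) :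
    (waveSpacetime m a).IsKillingHorizon (waveKilling a hp hq j)
        ({x | horizonFactor j x ≠ 0} ∩ wavefront m) ∧
      closure ({x | horizonFactor j x ≠ 0} ∩ wavefront m) = wavefront m :=
  isKillingHorizon_wavefront
    ((spacetimeOfForm_isKilling_iff _).2 fun x => killingEqAt_waveField hp' hq' hj x)
    (continuous_horizonFactor j) (fun _ hx => waveField_of_mem_wavefront hp0 hq0 j hx)
    (wavefront_subset_closure j)

theorem waveKilling_mem_degenerateKillingSet (hp0 : p 0 = 0) (hq0 : q 0 = 1)
    (hp' : ∀ t, HasDerivAt p (q t) t) (hq' : ∀ t, HasDerivAt q (a * p t) t)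
    {j : Fin (m + 1 + 1)} (hj : j ≠ 1) :
    waveKilling a hp hq j ∈ (waveSpacetime m a).degenerateKillingSet (wavefront m) := by
  obtain ⟨h1, h2⟩ := isKillingHorizon_waveKilling (hp := hp) (hq := hq) hp0 hq0 hp' hq'
    (fun h => absurd h hj)
  refine Or.inr ⟨_, h1, h2.trans isClosed_wavefront.closure_eq.symm,
    isSurfaceGravity_zero_of_fderiv inter_subset_right (h1.eq_on_wavefront h2) fun x _ v => ?_⟩
  refine fderiv_coord_zero_of_line ((contDiff_waveField hp hq j).differentiable (by simp))
    fun t => ?_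
  rw [waveField_zero_coord hj, waveField_zero_coord hj]

theorem waveKilling_mem_horizonKillingSet (hp0 : p 0 = 0) (hq0 : q 0 = 1)
    (hp' : ∀ t, HasDerivAt p (q t) t) (hq' : ∀ t, HasDerivAt q (a * p t) t)
    {j : Fin (m + 1 + 1)} (hj : j = 1 → a = 0) :
    waveKilling a hp hq j ∈ (waveSpacetime m a).horizonKillingSet (wavefront m) :=
  have h := isKillingHorizon_waveKilling (hp := hp) (hq := hq) hp0 hq0 hp' hq' hj
  Or.inr ⟨_, h.1, h.2.trans isClosed_wavefront.closure_eq.symm⟩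

theorem isMultipleKillingHorizon_wavefront (hp0 : p 0 = 0) (hq0 : q 0 = 1)
    (hp' : ∀ t, HasDerivAt p (q t) t) (hq' : ∀ t, HasDerivAt q (a * p t) t) {N : ℕ} (hN : 2 ≤ N)
    {σ : Fin N → Fin (m + 1 + 1)} (hσ : Function.Injective σ) (hσ1 : ∀ i, σ i = 1 → a = 0)
    (hp : ContDiff ℝ ∞ p) (hq : ContDiff ℝ ∞ q) :
    (waveSpacetime m a).IsMultipleKillingHorizon (wavefront m) := by
  refine ⟨?_, N, hN, fun i => waveKilling a hp hq (σ i),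
    (linearIndependent_waveKilling hp0 hq0).comp σ hσ,
    fun i => {x | horizonFactor (σ i) x ≠ 0} ∩ wavefront m, fun i => ?_⟩
  · have h := isNullHypersurface_wavefront (m := m) (a := a) isOpen_univ
    rwa [univ_inter] at h
  · have h := isKillingHorizon_waveKilling (hp := hp) (hq := hq) hp0 hq0 hp' hq' (hσ1 i)
    exact ⟨h.1, h.2.trans isClosed_wavefront.closure_eq.symm⟩

/-- On any of its horizons here the boost is v ∂_v with v ≠ 0, and the ∂_u-derivative of its square
is -2v, whereas zero surface gravity would make it 0. -/
theorem boost_not_mem_degenerateKillingSet (hp0 : p 0 = 0) (hq0 : q 0 = 1) :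
    waveKilling a hp hq 1 ∉ (waveSpacetime m a).degenerateKillingSet (wavefront m) := by
  rintro (h | ⟨K, hK, hcl, hκ⟩)
  · exact (linearIndependent_waveKilling hp0 hq0).ne_zero 1 h
  rw [isClosed_wavefront.closure_eq] at hcl
  have hne : K.Nonempty := closure_nonempty_iff.1 (hcl ▸ isConnected_wavefront.nonempty)
  obtain ⟨x, hx⟩ := hne
  have hxH : x ∈ wavefront m := hcl ▸ subset_closure hx
  have hX := waveField_of_mem_wavefront hp0 hq0 1 hxH
  have hx1 : horizonFactor 1 x ≠ 0 := by
    intro h0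
    refine hK.ne_zero x hx ?_
    rw [h0, zero_smul] at hX
    exact hX
  have h := (fderiv_norm_wavefront (waveKilling a hp hq 1) hX (stdVec 0)).symm.trans
    (hκ x hx (stdVec 0))
  have hd := hasDerivAt_coord_comp
    ((contDiff_waveField (m := m) hp hq 1).differentiable (by simp))
    (hasDerivAt_line x (stdVec 0) 0) 0
  have hd' : HasDerivAt (fun s : ℝ => waveField p q 1 (x + s • stdVec 0) 0) (-1) 0 := by
    have e : (fun s : ℝ => waveField p q 1 (x + s • stdVec 0) 0) = fun s => -(x 0 + s) := by
      ext s
      have : waveField (m := m) p q 1 = fun x => x 1 • stdVec 1 - x 0 • stdVec 0 := rfl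
      simp [this]
    rw [e]
    exact ((hasDerivAt_id _).const_add _).neg
  have h1 := hd.unique hd'
  rw [zero_smul, add_zero] at h1
  rw [toFun_waveKilling, h1] at h
  simp at h
  exact hx1 h

/-- The equation q' = a p for a = 0, p = id and q = 1. -/
theorem hasDerivAt_one (t : ℝ) : HasDerivAt (fun _ : ℝ => (1 : ℝ)) (0 * id t) t := by
  simpa using hasDerivAt_const t (1 : ℝ)

theorem isMultipleKillingHorizon_minkowski (m : ℕ) :
    (waveSpacetime m 0).IsMultipleKillingHorizon (wavefront m) :=
  isMultipleKillingHorizon_wavefront rfl rfl hasDerivAt_id hasDerivAt_one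
    (le_add_self : 2 ≤ m + 2) Function.injective_id (fun _ _ => rfl) contDiff_id contDiff_const

/-- `Fin.succAbove` at 1 omits the boost; the remaining m + 1 fields already reach the upper bound.
-/
theorem degenerateDim_minkowski (m : ℕ) :
    (waveSpacetime m 0).degenerateDim (wavefront m) = (m + 1 : ℕ) :=
  (degenerateDim_le (isMultipleKillingHorizon_minkowski m)).antisymm <|
    le_rank_span_of_linearIndependent
      ((linearIndependent_waveKilling (hp := contDiff_id) (hq := contDiff_const) rfl rfl).comp _
        (Fin.succAbove_right_injective (p := 1)))
      fun i => waveKilling_mem_degenerateKillingSet rfl rfl hasDerivAt_id hasDerivAt_one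
        (Fin.succAbove_ne 1 i)

theorem order_minkowski (m : ℕ) :
    (waveSpacetime m 0).order (wavefront m) = (m + 1 + 1 : ℕ) :=
  (order_le (isMultipleKillingHorizon_minkowski m)).antisymm <|
    le_rank_span_of_linearIndependent
      (linearIndependent_waveKilling (hp := contDiff_id) (hq := contDiff_const) rfl rfl)
      fun _ => waveKilling_mem_horizonKillingSet rfl rfl hasDerivAt_id hasDerivAt_one fun _ => rfl

theorem not_isFullyDegenerate_minkowski (m : ℕ) :
    ¬ (waveSpacetime m 0).IsFullyDegenerate (wavefront m) := fun h =>
  boost_not_mem_degenerateKillingSet (hp := contDiff_id) (hq := contDiff_const) rfl rfl <|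
    h.subset <| waveKilling_mem_horizonKillingSet rfl rfl hasDerivAt_id hasDerivAt_one fun _ => rfl

theorem hasDerivAt_cosh (t : ℝ) : HasDerivAt Real.cosh (1 * Real.sinh t) t := by
  simpa using Real.hasDerivAt_cosh t

theorem isMultipleKillingHorizon_planeWave {m : ℕ} (hm : 1 ≤ m) :
    (waveSpacetime m 1).IsMultipleKillingHorizon (wavefront m) :=
  isMultipleKillingHorizon_wavefront Real.sinh_zero Real.cosh_zero Real.hasDerivAt_sinh
    hasDerivAt_cosh (Nat.succ_le_succ hm) (Fin.succAbove_right_injective (p := 1))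
    (fun i h => absurd h (Fin.succAbove_ne 1 i)) Real.contDiff_sinh Real.contDiff_cosh

/-- Full degeneracy lowers the upper bound to m + 1, the number of explicit fields other than the
boost. -/
theorem order_planeWave {m : ℕ} (hm : 1 ≤ m) :
    (waveSpacetime m 1).order (wavefront m) = (m + 1 : ℕ) :=
  ((isFullyDegenerate_wavefront hm).order_le (isMultipleKillingHorizon_planeWave hm)).antisymm <|
    le_rank_span_of_linearIndependent
      ((linearIndependent_waveKilling (hp := Real.contDiff_sinh) (hq := Real.contDiff_cosh)
        Real.sinh_zero Real.cosh_zero).comp _ (Fin.succAbove_right_injective (p := 1)))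
      fun i => waveKilling_mem_horizonKillingSet Real.sinh_zero Real.cosh_zero
        Real.hasDerivAt_sinh hasDerivAt_cosh fun h => absurd h (Fin.succAbove_ne 1 i)

end Spacetime

end

theorem mainTheorem4 (n : ℕ) (hn : 1 ≤ n) :
    -- the upper bounds, for every multiple Killing horizon
    (∀ (S : Spacetime.{u} n) (H : Set S.Pt), S.IsMultipleKillingHorizon H →
      S.degenerateDim H ≤ n ∧
      (S.IsFullyDegenerate H → S.order H ≤ n) ∧
      (¬ S.IsFullyDegenerate H → S.order H ≤ n + 1)) ∧
    -- each of the bounds is attained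
    (∃ (S : Spacetime.{0} n) (H : Set S.Pt), S.IsMultipleKillingHorizon H ∧
      S.degenerateDim H = n) ∧
    (2 ≤ n → ∃ (S : Spacetime.{0} n) (H : Set S.Pt), S.IsMultipleKillingHorizon H ∧
      S.IsFullyDegenerate H ∧ S.order H = n) ∧
    (∃ (S : Spacetime.{0} n) (H : Set S.Pt), S.IsMultipleKillingHorizon H ∧
      ¬ S.IsFullyDegenerate H ∧ S.order H = n + 1) := by
  -- m is the number of transverse coordinates of the examples, besides u and v.
  obtain ⟨m, rfl⟩ : ∃ m, n = m + 1 := ⟨n - 1, by omega⟩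
  refine ⟨fun S H hH => ⟨Spacetime.degenerateDim_le hH, fun h => h.order_le hH, fun _ => ?_⟩,
    ⟨_, _, Spacetime.isMultipleKillingHorizon_minkowski m, Spacetime.degenerateDim_minkowski m⟩,
    fun hm => ⟨_, _, Spacetime.isMultipleKillingHorizon_planeWave (Nat.le_of_succ_le_succ hm),
      Spacetime.isFullyDegenerate_wavefront (Nat.le_of_succ_le_succ hm),
      Spacetime.order_planeWave (Nat.le_of_succ_le_succ hm)⟩,
    ⟨_, _, Spacetime.isMultipleKillingHorizon_minkowski m,
      Spacetime.not_isFullyDegenerate_minkowski m, ?_⟩⟩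
  · exact_mod_cast Spacetime.order_le hH
  · exact_mod_cast Spacetime.order_minkowski m
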